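/- Let $n\ge 2$. Write $\rho=|x|$ on $\mathbb{C}^n=\mathbb{R}^{2n}$, let $o$ be the origin, and let $B^{2n}$ be the open unit ball. Let $\theta=\frac{i}{2}\sum_j(z^jd\bar z^j-\bar z^jdz^j)$ be the standard contact form of $S^{2n-1}$ and $g_{\mathbb{CP}^{n-1}}$ the Fubini--Study metric of diameter $\pi/2$ (so that $\theta^2+g_{\mathbb{CP}^{n-1}}$ is the round metric of $S^{2n-1}$), both lifted to $\mathbb{R}^{2n}\setminus\{o\}=(0,\infty)\times S^{2n-1}$. For $c>0$ set $$Q_k(s)=s\int_1^s t^{-2}(t^2-1)^k\,dt,\qquad P(s)=(2n-1)Q_n(s)+2nc^{-1}Q_{n-1}(s),$$ and let $g_c$ be the metric on $B^{2n}\setminus\{o\}$ given by $$g_c=\frac{(s^2-1)^{n-1}}{P(s)}\,ds^2+\frac{c^2P(s)}{(s^2-1)^{n-1}}\,\theta^2+c(s^2-1)\,g_{\mathbb{CP}^{n-1}},\qquad s=1+\frac{2c^{-1}\rho^2}{1-\rho^2}.$$ Let $X^*=(0,\infty)\times\mathbb{CP}^{n-1}$, with $r$ denoting the first coordinate, let $$g_0=dr^2+\frac{2n}{2n-3}\sinh^2r\cdot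 g_{\mathbb{CP}^{n-1}}$$ on $X^*$, and let $p\colon\mathbb{R}^{2n}\setminus\{o\}\to X^*$, $p(x)=(|x|,[x])$. Put $B_R=\{0<r<R\}$ and $B_{R_1,R_2}=\{R_1<r<R_2\}$ in $X^*$. Then there is a family of $SU(n)$-equivariant diffeomorphisms $\Phi_c\colon\mathbb{R}^{2n}\setminus\{o\}\to B^{2n}\setminus\{o\}$, $c>0$, with the following properties. (i) Each $\Phi_c$ extends to a homeomorphism $\mathbb{R}^{2n}\to B^{2n}$. (ii) For each $c>0$ there is a (necessarily unique) Riemannian metric $g'_c$ on $X^*$ for which $p\colon(\mathbb{R}^{2n}\setminus\{o\},\Phi_c^*g_c)\to(X^*,g'_c)$ is a Riemannian submersion, and $g'_c\to g_0$ as $c\to 0$ in the $C^\infty$ topology on $B_{R_1,R_2}$ for all $0<R_1<R_2$. (iii) For every $R>0$, the diameters of the fibers of $p\colon(\mathbb{R}^{2n}\setminus\{o\},\Phi_c^*g_c)\to(X^*,g'_c)$, with respect to the induced metrics on the fibers, converge to zero as $c\to 0$, uniformly over $B_R$. -/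

import Mathlib

open Set Filter Topology Manifold
open scoped ContDiff ENNReal LinearAlgebra.Projectivization

noncomputable section

/-! ## Symmetric two-tensors, Riemannian metrics and Riemannian submersions -/

section General

variable {E : Type*} [NormedAddCommGroup E] [NormedSpace ℝ E]
  {H : Type*} [TopologicalSpace H]
  {E' : Type*} [NormedAddCommGroup E'] [NormedSpace ℝ E']
  {H' : Type*} [TopologicalSpace H']

/-- Fields of (continuous) bilinear forms on the tangent spaces of a manifold `M`. -/
abbrev FormField (I : ModelWithCorners ℝ E H) (M : Type*) [TopologicalSpace M]
    [ChartedSpace H M] :=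
  ∀ x : M, TangentSpace I x →L[ℝ] TangentSpace I x →L[ℝ] ℝ

/-- The pullback `f^* g`, that is `(f^* g)_x(u, v) = g_{f x}(df_x u, df_x v)`. -/
def pullbackForm (I : ModelWithCorners ℝ E H) (I' : ModelWithCorners ℝ E' H')
    {M : Type*} [TopologicalSpace M] [ChartedSpace H M]
    {N : Type*} [TopologicalSpace N] [ChartedSpace H' N]
    (f : M → N) (g : FormField I' N) : FormField I M := fun x =>
  ((mfderiv I I' f x).precomp ℝ) ∘L (g (f x)) ∘L (mfderiv I I' f x)

variable (I : ModelWithCorners ℝ E H) (I' : ModelWithCorners ℝ E' H')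
  {M : Type*} [TopologicalSpace M] [ChartedSpace H M]
  {N : Type*} [TopologicalSpace N] [ChartedSpace H' N]

/-- The coefficients of a field of bilinear forms in a chart `e`: the pullback of `g` under the
inverse of `e`, a function on an open subset of the model vector space (for manifolds without
boundary). -/
def coordForm (e : OpenPartialHomeomorph M H) (g : FormField I M) :
    E → E →L[ℝ] E →L[ℝ] ℝ := fun y =>
  pullbackForm 𝓘(ℝ, E) I (e.extend I).symm g y

/-- `g` is a smooth Riemannian metric on the open subset `U` of the (boundaryless) manifold `M`:
symmetric, positive definite, with smooth coefficients in all charts of the atlas. -/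
structure IsRiemannianMetricOn (U : Set M) (g : FormField I M) : Prop where
  symm : ∀ x ∈ U, ∀ u v : TangentSpace I x, g x u v = g x v u
  pos : ∀ x ∈ U, ∀ u : TangentSpace I x, u ≠ 0 → 0 < g x u u
  smooth : ∀ e ∈ atlas H M, ContDiffOn ℝ ∞ (coordForm I e g)
    ((e.extend I).target ∩ (e.extend I).symm ⁻¹' U)

/-- `f : (U, g) → (W, h)` is a (surjective) Riemannian submersion between open subsets of
manifolds: it is a smooth surjective submersion and `df_x` restricts to an isometry from the
`g`-orthogonal complement of `ker df_x` to the tangent space at `f x`. -/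
structure IsRiemannianSubmersionOn (U : Set M) (W : Set N) (f : M → N)
    (g : FormField I M) (h : FormField I' N) : Prop where
  metric_source : IsRiemannianMetricOn I U g
  metric_target : IsRiemannianMetricOn I' W h
  smooth : ContMDiffOn I I' ∞ f U
  image_eq : f '' U = W
  submersion : ∀ x ∈ U, Function.Surjective (mfderiv I I' f x)
  isometry : ∀ x ∈ U, ∀ u v : TangentSpace I x,
    (∀ k : TangentSpace I x, mfderiv I I' f x k = 0 → g x u k = 0) →
    (∀ k : TangentSpace I x, mfderiv I I' f x k = 0 → g x v k = 0) →
    h (f x) (mfderiv I I' f x u) (mfderiv I I' f x v) = g x u v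

/-- Convergence `g c → g₀` along `l` in the `C^∞` topology on the subset `S`: in each chart of the
atlas, and over each compact subset `K` of the chart domain, the partial derivatives of all orders
of the coefficients converge uniformly on `S ∩ K`.  (To be used for sets `S` whose closure is a
compact subset of an open set on which all the forms are smooth.) -/
def SmoothlyConvergesOn {ι : Type*} (S : Set M) (g : ι → FormField I M) (l : Filter ι)
    (g₀ : FormField I M) : Prop :=
  ∀ e ∈ atlas H M, ∀ K : Set M, IsCompact K → K ⊆ e.source → ∀ k : ℕ,
    TendstoUniformlyOn (fun c => iteratedFDeriv ℝ k (coordForm I e (g c)))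
      (iteratedFDeriv ℝ k (coordForm I e g₀)) l (e.extend I '' (S ∩ K))

end General

/-- `f` restricts to a `C^∞` diffeomorphism from `U` onto `W` (open subsets of normed spaces). -/
def IsDiffeoOn {E F : Type*} [NormedAddCommGroup E] [NormedSpace ℝ E]
    [NormedAddCommGroup F] [NormedSpace ℝ F] (f : E → F) (U : Set E) (W : Set F) : Prop :=
  ContDiffOn ℝ ∞ f U ∧ BijOn f U W ∧ ∃ f' : F → E, ContDiffOn ℝ ∞ f' W ∧ InvOn f' f U W

/-- The length, with respect to `g`, of a curve `γ : [0,1] → V` in a normed space. -/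
def curveLength {V : Type*} [NormedAddCommGroup V] [NormedSpace ℝ V]
    (g : FormField 𝓘(ℝ, V) V) (γ : ℝ → V) : ℝ≥0∞ :=
  ∫⁻ t in Icc (0 : ℝ) 1, ENNReal.ofReal
    (Real.sqrt (g (γ t) (derivWithin γ (Icc 0 1) t) (derivWithin γ (Icc 0 1) t)))

/-- The diameter of a submanifold `F` with respect to the Riemannian distance of the metric
induced by `g`: distances are infima of the lengths of `C^1` curves contained in `F`. -/
def intrinsicDiam {V : Type*} [NormedAddCommGroup V] [NormedSpace ℝ V]
    (g : FormField 𝓘(ℝ, V) V) (F : Set V) : ℝ≥0∞ :=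
  ⨆ x ∈ F, ⨆ y ∈ F, ⨅ (γ : ℝ → V)
    (_ : ContDiffOn ℝ 1 γ (Icc 0 1) ∧ MapsTo γ (Icc 0 1) F ∧ γ 0 = x ∧ γ 1 = y),
    curveLength g γ

/-! ## Complex Euclidean space -/

/-- The space `ℂ^n = ℝ^{2n}` with its Euclidean norm. -/
abbrev CSpace (n : ℕ) := EuclideanSpace ℂ (Fin n)

/-- The real-linear functional `v ↦ Re ⟨x, v⟩`. -/
def reInner {n : ℕ} (x : CSpace n) : CSpace n →L[ℝ] ℝ :=
  Complex.reCLM ∘L (innerSL ℂ x).restrictScalars ℝ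

/-- The real-linear functional `v ↦ Im ⟨x, v⟩`. -/
def imInner {n : ℕ} (x : CSpace n) : CSpace n →L[ℝ] ℝ :=
  Complex.imCLM ∘L (innerSL ℂ x).restrictScalars ℝ

/-- The Euclidean metric `(u, v) ↦ Re ⟨u, v⟩`. -/
def euclForm (n : ℕ) : CSpace n →L[ℝ] CSpace n →L[ℝ] ℝ := innerSL ℝ

/-- The square `ℓ ⊗ ℓ` of a linear functional. -/
def sqForm {E : Type*} [NormedAddCommGroup E] [NormedSpace ℝ E] (ℓ : E →L[ℝ] ℝ) :
    E →L[ℝ] E →L[ℝ] ℝ := ℓ.smulRight ℓ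

/-- The action of a complex matrix on `ℂ^n`. -/
def matAct {n : ℕ} (A : Matrix (Fin n) (Fin n) ℂ) (x : CSpace n) : CSpace n :=
  WithLp.toLp 2 (A.mulVec x.ofLp)

/-! ## Complex projective space -/

/-- Complex projective space of complex dimension `m`: the lines in `ℂ^{m+1}`. -/
abbrev CP (m : ℕ) := ℙ ℂ (CSpace (m + 1))

/-- The quotient topology. -/
instance instTopologicalSpaceCP (m : ℕ) : TopologicalSpace (CP m) :=
  inferInstanceAs (TopologicalSpace (Quotient (projectivizationSetoid ℂ (CSpace (m + 1)))))

namespace CP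

variable {m : ℕ}

theorem isQuotientMap_mk' :
    IsQuotientMap (Projectivization.mk' ℂ : {z : CSpace (m + 1) // z ≠ 0} → CP m) :=
  isQuotientMap_quot_mk

/-- The vector of `ℂ^{m+1}` with `i`-th coordinate `1` and the other coordinates given by `w`. -/
def affineLift (i : Fin (m + 1)) (w : CSpace m) : CSpace (m + 1) :=
  WithLp.toLp 2 (Fin.insertNth i 1 w.ofLp)

@[simp] theorem affineLift_same (i : Fin (m + 1)) (w : CSpace m) : affineLift i w i = 1 := by
  simp [affineLift]

@[simp] theorem affineLift_succAbove (i : Fin (m + 1)) (w : CSpace m) (j : Fin m) :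
    affineLift i w (i.succAbove j) = w j := by
  simp [affineLift]

theorem affineLift_ne_zero (i : Fin (m + 1)) (w : CSpace m) : affineLift i w ≠ 0 := fun h => by
  have := congrArg (fun z : CSpace (m + 1) => z i) h
  simp at this

theorem contDiff_affineLift (i : Fin (m + 1)) : ContDiff ℝ ω (affineLift (m := m) i) := by
  rw [contDiff_piLp 2]
  intro k
  rcases Fin.eq_self_or_eq_succAbove i k with rfl | ⟨j, rfl⟩
  · simpa using contDiff_const
  · simpa using (contDiff_piLp_apply (𝕜 := ℝ) (E := fun _ : Fin m => ℂ) (i := j) 2)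

/-- The set of lines on which the `i`-th coordinate does not vanish. -/
def affineDomain (i : Fin (m + 1)) : Set (CP m) :=
  {L | Projectivization.lift (fun z : {z : CSpace (m + 1) // z ≠ 0} => z.1 i ≠ 0)
    (by
      rintro ⟨a, ha⟩ ⟨b, hb⟩ t h
      have ht : t ≠ 0 := by rintro rfl; exact ha (by simpa using h)
      dsimp only at h
      subst h
      simp [ht]) L}

/-- The affine coordinates `[z] ↦ (z_j / z_i)_{j ≠ i}`. -/
def affineCoord (i : Fin (m + 1)) (L : CP m) : CSpace m :=
  Projectivization.lift (fun z : {z : CSpace (m + 1) // z ≠ 0} =>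
      (WithLp.toLp 2 (fun j => z.1 (i.succAbove j) / z.1 i) : CSpace m))
    (by
      rintro ⟨a, ha⟩ ⟨b, hb⟩ t h
      have ht : t ≠ 0 := by rintro rfl; exact ha (by simpa using h)
      dsimp only at h
      subst h
      ext j
      simp [mul_div_mul_left _ _ ht]) L

theorem mem_affineDomain_mk (i : Fin (m + 1)) (z : CSpace (m + 1)) (hz : z ≠ 0) :
    Projectivization.mk ℂ z hz ∈ affineDomain i ↔ z i ≠ 0 := Iff.rfl

theorem affineCoord_mk (i : Fin (m + 1)) (z : CSpace (m + 1)) (hz : z ≠ 0) :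
    affineCoord i (Projectivization.mk ℂ z hz) =
      WithLp.toLp 2 (fun j => z (i.succAbove j) / z i) := rfl

theorem isOpen_affineDomain (i : Fin (m + 1)) : IsOpen (affineDomain (m := m) i) := by
  rw [← isQuotientMap_mk'.isOpen_preimage]
  exact isOpen_ne_fun (by fun_prop) continuous_const

/-- The affine chart `[z] ↦ (z_j / z_i)_{j ≠ i}` of projective space. -/
def affineChart (i : Fin (m + 1)) : OpenPartialHomeomorph (CP m) (CSpace m) where
  toFun := affineCoord i
  invFun w := Projectivization.mk ℂ (affineLift i w) (affineLift_ne_zero i w)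
  source := affineDomain i
  target := univ
  map_source' _ _ := mem_univ _
  map_target' w _ := by simp [mem_affineDomain_mk]
  left_inv' L hL := by
    induction L using Projectivization.ind with | h z hz =>
    rw [mem_affineDomain_mk] at hL
    rw [Projectivization.mk_eq_mk_iff']
    refine ⟨(z i)⁻¹, ?_⟩
    ext k
    rcases Fin.eq_self_or_eq_succAbove i k with rfl | ⟨j, rfl⟩
    · simp [hL]
    · simp [affineCoord_mk, div_eq_inv_mul]
  right_inv' w _ := by
    ext j
    simp [affineCoord_mk]
  open_source := isOpen_affineDomain i
  open_target := isOpen_univ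
  continuousOn_toFun := by
    rw [isQuotientMap_mk'.continuousOn_isOpen_iff (isOpen_affineDomain i)]
    refine (PiLp.continuous_toLp 2 _).comp_continuousOn (continuousOn_pi.2 fun j => ?_)
    refine ContinuousOn.div (by fun_prop) (by fun_prop) fun z hz => hz
  continuousOn_invFun := by
    refine Continuous.continuousOn ?_
    exact isQuotientMap_mk'.continuous.comp
      ((contDiff_affineLift i).continuous.subtype_mk (affineLift_ne_zero i))

theorem exists_mem_affineDomain (L : CP m) : ∃ i, L ∈ affineDomain i := by
  induction L using Projectivization.ind with | h z hz =>
  by_contra! h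
  refine hz ?_
  ext i
  simpa [mem_affineDomain_mk] using h i

/-- Projective space is covered by the affine charts. -/
instance instChartedSpace : ChartedSpace (CSpace m) (CP m) where
  atlas := range affineChart
  chartAt L := affineChart (exists_mem_affineDomain L).choose
  mem_chart_source L := (exists_mem_affineDomain L).choose_spec
  chart_mem_atlas _ := mem_range_self _

/-- Projective space is a (real) smooth manifold. -/
instance instIsManifold : IsManifold 𝓘(ℝ, CSpace m) ∞ (CP m) := by
  refine isManifold_of_contDiffOn _ _ _ ?_
  rintro _ _ ⟨i, rfl⟩ ⟨j, rfl⟩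
  simp only [modelWithCornersSelf_coe, modelWithCornersSelf_coe_symm, Function.comp_id,
    Function.id_comp, preimage_id, range_id, inter_univ, OpenPartialHomeomorph.coe_trans]
  rw [contDiffOn_piLp 2]
  intro k
  have h : ∀ l : Fin (m + 1), ContDiff ℝ ∞ (fun w : CSpace m => affineLift i w l) := fun l =>
    ((contDiff_piLp 2).1 ((contDiff_affineLift i).of_le le_top)) l
  have : ContDiffOn ℝ ∞ (fun w : CSpace m => affineLift i w (j.succAbove k) / affineLift i w j)
      ((affineChart i).symm.trans (affineChart j)).source := by
    simp only [div_eq_mul_inv]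
    refine (h _).contDiffOn.mul ((h _).contDiffOn.inv fun w hw => ?_)
    exact hw.2
  exact this

/-- The Fubini-Study metric in affine coordinates,
`Re (⟨u, v⟩ / (1 + |w|²) - ⟨u, w⟩ ⟨w, v⟩ / (1 + |w|²)²)`; its diameter is `π / 2`. -/
def fubiniStudyCoord (w : CSpace m) : CSpace m →L[ℝ] CSpace m →L[ℝ] ℝ :=
  (1 + ‖w‖ ^ 2)⁻¹ • euclForm m
    - ((1 + ‖w‖ ^ 2) ^ 2)⁻¹ • (sqForm (reInner w) + sqForm (imInner w))

/-- The Fubini-Study metric on projective space, of diameter `π / 2`. -/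
def fubiniStudy (m : ℕ) : FormField 𝓘(ℝ, CSpace m) (CP m) := fun L =>
  pullbackForm 𝓘(ℝ, CSpace m) 𝓘(ℝ, CSpace m) (chartAt (CSpace m) L) fubiniStudyCoord L

end CP

/-! ## The space `X^* = (0, ∞) × CP^m`, as an open subset of `ℝ × CP^m` -/

/-- The model with corners of `ℝ × CP^m`. -/
abbrev XModel (m : ℕ) := (𝓘(ℝ, ℝ)).prod 𝓘(ℝ, CSpace m)

/-- The subset `X^* = (0, ∞) × CP^m`. -/
def XStar (m : ℕ) : Set (ℝ × CP m) := {b | 0 < b.1}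

/-- The subset `B_R = {0 < r < R}`. -/
def XBall (m : ℕ) (R : ℝ) : Set (ℝ × CP m) := {b | 0 < b.1 ∧ b.1 < R}

/-- The subset `B_{R₁,R₂} = {R₁ < r < R₂}`. -/
def XAnnulus (m : ℕ) (R₁ R₂ : ℝ) : Set (ℝ × CP m) := {b | R₁ < b.1 ∧ b.1 < R₂}

/-- The map `p : ℂ^{m+1} ∖ {0} → (0, ∞) × CP^m`, given in polar coordinates by
`(r, q) ↦ (r, φ(q))` with the Hopf map `φ`; thus `p(x) = (|x|, [x])`.  The value at `0` is
arbitrary. -/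
def hopfProj {m : ℕ} (x : CSpace (m + 1)) : ℝ × CP m :=
  (‖x‖, if h : x ≠ 0 then Projectivization.mk ℂ x h else Classical.arbitrary _)

/-- The metric `g_0 = dr² + (2n / (2n - 3)) sinh² r · g_{CP^{n-1}}`, where `n = m + 1`. -/
def limitMetric (m : ℕ) : FormField (XModel m) (ℝ × CP m) := fun b =>
  pullbackForm (XModel m) 𝓘(ℝ, ℝ) Prod.fst (fun _ => sqForm (ContinuousLinearMap.id ℝ ℝ)) b
    + ((2 * ((m : ℝ) + 1)) / (2 * ((m : ℝ) + 1) - 3) * Real.sinh b.1 ^ 2) •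
      pullbackForm (XModel m) 𝓘(ℝ, CSpace m) Prod.snd (CP.fubiniStudy m) b

/-! ## The metrics `g_c` on the punctured unit ball of `ℂ^n` -/

/-- `Q_k(r) = r ∫_1^r t^{-2} (t² - 1)^k dt`. -/
def polyQ (k : ℕ) (r : ℝ) : ℝ := r * ∫ t in (1 : ℝ)..r, (t ^ 2)⁻¹ * (t ^ 2 - 1) ^ k

/-- `P_n(r) = (2n - 1) Q_n(r) + 2n c^{-1} Q_{n-1}(r)`. -/
def polyP (n : ℕ) (c r : ℝ) : ℝ :=
  (2 * (n : ℝ) - 1) * polyQ n r + 2 * (n : ℝ) * c⁻¹ * polyQ (n - 1) r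

/-- `α(r)² = (r² - 1)^{n-1} / P_n(r)`. -/
def alphaSq (n : ℕ) (c r : ℝ) : ℝ := (r ^ 2 - 1) ^ (n - 1) / polyP n c r

/-- `β(r)² = c² P_n(r) / (r² - 1)^{n-1}`. -/
def betaSq (n : ℕ) (c r : ℝ) : ℝ := c ^ 2 * polyP n c r / (r ^ 2 - 1) ^ (n - 1)

/-- `γ(r)² = c (r² - 1)`. -/
def gammaSq (c r : ℝ) : ℝ := c * (r ^ 2 - 1)

/-- The change of variable `r = 1 + 2 c^{-1} ρ² / (1 - ρ²)`, `0 < ρ < 1`. -/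
def radialVar (c ρ : ℝ) : ℝ := 1 + 2 * c⁻¹ * ρ ^ 2 / (1 - ρ ^ 2)

/-- The one-form `dρ` on `ℂ^n ∖ {0}`, where `ρ = |x|`. -/
def dRho {n : ℕ} (x : CSpace n) : CSpace n →L[ℝ] ℝ := ‖x‖⁻¹ • reInner x

/-- The standard contact form `θ = (i/2) ∑ (z^j d z̄^j - z̄^j dz^j)` of the unit sphere, pulled back
to `ℂ^n ∖ {0}` by `x ↦ x / |x|`. -/
def thetaForm {n : ℕ} (x : CSpace n) : CSpace n →L[ℝ] ℝ := (‖x‖ ^ 2)⁻¹ • imInner x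

/-- The Fubini-Study metric of diameter `π / 2`, pulled back to `ℂ^n ∖ {0}` by `x ↦ [x]`:
`Re (⟨u, v⟩ / |x|² - ⟨u, x⟩ ⟨x, v⟩ / |x|⁴)`. -/
def fubiniStudyLift {n : ℕ} (x : CSpace n) : CSpace n →L[ℝ] CSpace n →L[ℝ] ℝ :=
  (‖x‖ ^ 2)⁻¹ • euclForm n - (‖x‖ ^ 4)⁻¹ • (sqForm (reInner x) + sqForm (imInner x))

/-- The metric `g_c = α(r)² dr² + β(r)² θ² + γ(r)² g_{CP^{n-1}}`, `r = r(ρ)`, on the punctured unit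
ball of `ℂ^n` (values elsewhere are irrelevant). -/
def ballMetric (n : ℕ) (c : ℝ) : FormField 𝓘(ℝ, CSpace n) (CSpace n) := fun x =>
  (alphaSq n c (radialVar c ‖x‖) * deriv (radialVar c) ‖x‖ ^ 2) • sqForm (dRho x)
    + betaSq n c (radialVar c ‖x‖) • sqForm (thetaForm x)
    + gammaSq c (radialVar c ‖x‖) • fubiniStudyLift x

end

/-! Everything is radial, so the only choice is the new radius $r$. It is fixed by $c(s^2-1)=X$ with
$X=\kappa\sinh^2 r$ and $\kappa=2n/(2n-3)$. The $\mathbb{CP}^{n-1}$ coefficient is then $X$ for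
every $c$, already that of $g_0$. The map $\Phi_c$ sends $x$ to $\rho(r)\,x/|x|$ with $r=|x|$, where
$\rho(r)$ inverts $s(\rho)$. It preserves $\theta$ and the lifted Fubini–Study form, so the pulled
back metric is $A\,dr^2+B\,\theta^2+X g_{\mathbb{CP}^{n-1}}$ (`formEval_pullback_ballMetric`). The
fibers of $p$ are the circles $e^{i\varphi}x$, and the quotient metric is $A\,dr^2+X
g_{\mathbb{CP}^{n-1}}$.

For (ii) put $\varepsilon=\sqrt c$. The closed form of $Q_k$ (`polyQ_eq_sum`) shows that
$\varepsilon^{2n}P(s)$ extends smoothly in $(\varepsilon,r)$ across $\varepsilon=0$, with value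
$X^{n-1}(X+\kappa)$ there (`scaledP_zero`). Since $X+\kappa=\kappa\cosh^2 r$, this gives $A=1$ at
$\varepsilon=0$ (`radialCoeff_zero`). Joint smoothness in $\varepsilon$ and the chart coordinates
then gives uniform convergence of all derivatives on compact sets
(`tendstoUniformlyOn_iteratedFDeriv_of_uncurry`).

For (iii), $B\le\sqrt c$ times a function of $X$ bounded on each $B_R$ (`fiberCoeff_le`), and a
fiber has diameter at most $\pi\sqrt B$. -/

noncomputable section

/-! ### Bilinear forms, derivatives and pullbacks read in the model vector spaces. -/

section Pullback

variable {E : Type*} [NormedAddCommGroup E] [NormedSpace ℝ E]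
  {H : Type*} [TopologicalSpace H] {I : ModelWithCorners ℝ E H}
  {E' : Type*} [NormedAddCommGroup E'] [NormedSpace ℝ E']
  {H' : Type*} [TopologicalSpace H'] {I' : ModelWithCorners ℝ E' H'}
  {E'' : Type*} [NormedAddCommGroup E''] [NormedSpace ℝ E'']
  {H'' : Type*} [TopologicalSpace H''] {I'' : ModelWithCorners ℝ E'' H''}
  {M : Type*} [TopologicalSpace M] [ChartedSpace H M]
  {N : Type*} [TopologicalSpace N] [ChartedSpace H' N]
  {N' : Type*} [TopologicalSpace N'] [ChartedSpace H'' N']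

/-- The value of a field of bilinear forms on two vectors of the model vector space. -/
def formEval (I : ModelWithCorners ℝ E H) (g : FormField I M) (x : M) (u v : E) : ℝ :=
  (g x : E →L[ℝ] E →L[ℝ] ℝ) u v

/-- The derivative of a map between manifolds, as a map between the model vector spaces. -/
def modelDeriv (I : ModelWithCorners ℝ E H) (I' : ModelWithCorners ℝ E' H') (f : M → N) (x : M) :
    E →L[ℝ] E' :=
  mfderiv I I' f x

variable (I I' I'')

theorem modelDeriv_vectorSpace (f : E → E') (x : E) :
    modelDeriv 𝓘(ℝ, E) 𝓘(ℝ, E') f x = fderiv ℝ f x :=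
  mfderiv_eq_fderiv

theorem modelDeriv_comp {f : M → N} {f' : N → N'} {x : M}
    (hf' : MDifferentiableAt I' I'' f' (f x)) (hf : MDifferentiableAt I I' f x) :
    modelDeriv I I'' (f' ∘ f) x = (modelDeriv I' I'' f' (f x)).comp (modelDeriv I I' f x) :=
  mfderiv_comp x hf' hf

theorem modelDeriv_congr {f f' : M → N} {x : M} (h : f =ᶠ[𝓝 x] f') :
    modelDeriv I I' f x = modelDeriv I I' f' x :=
  h.mfderiv_eq

theorem formEval_pullbackForm (f : M → N) (g : FormField I' N) (x : M) (u v : E) :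
    formEval I (pullbackForm I I' f g) x u v =
      formEval I' g (f x) (modelDeriv I I' f x u) (modelDeriv I I' f x v) := rfl

theorem formEval_pullbackForm_vectorSpace (f : M → E') (g : E' → E' →L[ℝ] E' →L[ℝ] ℝ) (x : M)
    (u v : E) : formEval I (pullbackForm I 𝓘(ℝ, E') f g) x u v =
      g (f x) (modelDeriv I 𝓘(ℝ, E') f x u) (modelDeriv I 𝓘(ℝ, E') f x v) := rfl

theorem formEval_pullbackForm_comp {f : M → N} {f' : N → N'} (g : FormField I'' N') {x : M}
    (hf' : MDifferentiableAt I' I'' f' (f x)) (hf : MDifferentiableAt I I' f x) (u v : E) :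
    formEval I (pullbackForm I I'' (f' ∘ f) g) x u v =
      formEval I' (pullbackForm I' I'' f' g) (f x) (modelDeriv I I' f x u)
        (modelDeriv I I' f x v) := by
  rw [formEval_pullbackForm, formEval_pullbackForm, modelDeriv_comp I I' I'' hf' hf]
  rfl

end Pullback

/-! ### Smooth dependence on a parameter and convergence of all derivatives. -/

section Parametric

variable {E : Type*} [NormedAddCommGroup E] [NormedSpace ℝ E]
  {F : Type*} [NormedAddCommGroup F] [NormedSpace ℝ F]
  {G : Type*} [NormedAddCommGroup G] [NormedSpace ℝ G]

/-- Induction on `k`: up to a currying isometry, each further partial derivative in `E` is an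
`fderiv`, and this operation preserves joint smoothness. -/
theorem contDiffOn_iteratedFDeriv_of_uncurry {Ψ : G → E → F} {U : Set (G × E)} (hU : IsOpen U)
    (h : ContDiffOn ℝ ∞ (Function.uncurry Ψ) U) (k : ℕ) :
    ContDiffOn ℝ ∞ (fun z : G × E => iteratedFDeriv ℝ k (Ψ z.1) z.2) U := by
  induction k with
  | zero =>
    have : (fun z : G × E => iteratedFDeriv ℝ 0 (Ψ z.1) z.2) =
        (continuousMultilinearCurryFin0 ℝ E F).symm ∘ Function.uncurry Ψ := by
      ext z; simp [Function.uncurry]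
    rw [this]
    exact (continuousMultilinearCurryFin0 ℝ E F).symm.contDiff.comp_contDiffOn h
  | succ k ih =>
    have : (fun z : G × E => iteratedFDeriv ℝ (k + 1) (Ψ z.1) z.2) =
        (continuousMultilinearCurryLeftEquiv ℝ (fun _ : Fin (k + 1) => E) F).symm ∘
          fun z : G × E => fderiv ℝ (iteratedFDeriv ℝ k (Ψ z.1)) z.2 := by
      ext z : 1
      simp only [iteratedFDeriv_succ_eq_comp_left, Function.comp_apply]
    rw [this]
    have hL : ContDiff ℝ ∞
        (continuousMultilinearCurryLeftEquiv ℝ (fun _ : Fin (k + 1) => E) F).symm :=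
      LinearIsometryEquiv.contDiff (𝕜 := ℝ) (E := E →L[ℝ] E [×k]→L[ℝ] F) (F := E [×(k + 1)]→L[ℝ] F)
        (continuousMultilinearCurryLeftEquiv ℝ (fun _ : Fin (k + 1) => E) F).symm
    refine hL.comp_contDiffOn fun z hz => ?_
    refine ContDiffAt.contDiffWithinAt ?_
    refine ContDiffAt.fderiv (n := ∞) (m := ∞) (f := fun z : G × E => iteratedFDeriv ℝ k (Ψ z.1))
      (g := Prod.snd) ?_ contDiffAt_snd (by simp)
    have h1 : ContDiffAt ℝ ∞ (fun z : G × E => iteratedFDeriv ℝ k (Ψ z.1) z.2) z :=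
      ih.contDiffAt (hU.mem_nhds hz)
    -- The parameter here is the whole pair `z`; its `E`-component is discarded, since only the
    -- separate variable `p.2` is differentiated.
    exact ContDiffAt.comp (z, z.2) (f := fun p : (G × E) × E => (p.1.1, p.2)) h1
      (by fun_prop)

/-- Smooth dependence on a parameter gives convergence of all derivatives, uniformly on compact
sets. -/
theorem tendstoUniformlyOn_iteratedFDeriv_of_uncurry {ι : Type*} {l : Filter ι} {e : ι → G} {a : G}
    (he : Tendsto e l (𝓝 a)) {Ψ : G → E → F} {U : Set (G × E)} (hU : IsOpen U)
    (h : ContDiffOn ℝ ∞ (Function.uncurry Ψ) U) {K : Set E} (hK : IsCompact K)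
    (hKU : ∀ y ∈ K, (a, y) ∈ U) (k : ℕ) :
    TendstoUniformlyOn (fun i => iteratedFDeriv ℝ k (Ψ (e i))) (iteratedFDeriv ℝ k (Ψ a)) l K := by
  have hc := (contDiffOn_iteratedFDeriv_of_uncurry hU h k).continuousOn
  rw [Metric.tendstoUniformlyOn_iff]
  intro δ hδ
  have key : ∀ᶠ g in 𝓝 a, ∀ y ∈ K,
      dist (iteratedFDeriv ℝ k (Ψ a) y) (iteratedFDeriv ℝ k (Ψ g) y) < δ := by
    -- Tube lemma: the estimate near each `(a, y)` suffices, and compactness of `K` then gives one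
    -- neighbourhood of `a`.
    refine hK.eventually_forall_of_forall_eventually fun y hy => ?_
    have h1 : ContinuousAt (fun z : G × E => iteratedFDeriv ℝ k (Ψ z.1) z.2) (a, y) :=
      hc.continuousAt (hU.mem_nhds (hKU y hy))
    have h2 : ContinuousAt (fun z : G × E => iteratedFDeriv ℝ k (Ψ a) z.2) (a, y) := by
      exact ContinuousAt.comp (x := (a, y)) (f := fun z : G × E => (a, z.2)) h1 (by fun_prop)
    have h3 := (h2.dist h1).eventually (gt_mem_nhds (show dist _ _ < δ by simpa using hδ))
    exact h3
  exact he.eventually key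

end Parametric

/-! ### Radial maps of a normed space. -/

section Radial

variable {V : Type*} [NormedAddCommGroup V] [NormedSpace ℝ V]

/-- The map `x ↦ f(|x|) x / |x|`. -/
def radialMap (f : ℝ → ℝ) (x : V) : V := (f ‖x‖ / ‖x‖) • x

theorem norm_radialMap {f : ℝ → ℝ} {x : V} (hx : x ≠ 0) (hf : 0 ≤ f ‖x‖) :
    ‖radialMap f x‖ = f ‖x‖ := by
  have : ‖x‖ ≠ 0 := norm_ne_zero_iff.2 hx
  rw [radialMap, norm_smul, Real.norm_eq_abs, abs_of_nonneg (by positivity)]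
  field_simp

@[simp] theorem radialMap_zero (f : ℝ → ℝ) : radialMap f (0 : V) = 0 := by simp [radialMap]

theorem radialMap_radialMap {f g : ℝ → ℝ} {x : V} (hf : 0 < f ‖x‖) (hg : g (f ‖x‖) = ‖x‖) :
    radialMap g (radialMap f x) = x := by
  rcases eq_or_ne x 0 with rfl | hx
  · simp
  have h1 : ‖x‖ ≠ 0 := norm_ne_zero_iff.2 hx
  rw [radialMap, norm_radialMap hx hf.le, hg, radialMap, smul_smul]
  convert one_smul ℝ x using 2
  field_simp

theorem continuousOn_radialMap {f : ℝ → ℝ} {s : Set V} {t : Set ℝ} (hst : MapsTo norm s t)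
    (hf : ContinuousOn f t) (h0 : f 0 = 0) : ContinuousOn (radialMap f) s := by
  have hfn : ContinuousOn (fun x : V => f ‖x‖) s := hf.comp continuous_norm.continuousOn hst
  intro x hx
  rcases eq_or_ne x 0 with rfl | hx0
  -- The quotient `f ‖y‖ / ‖y‖` may blow up at the origin, but the norm of the image is at most `|f
  -- ‖y‖|`, which tends to `|f 0| = 0`.
  · rw [ContinuousWithinAt, radialMap_zero, tendsto_zero_iff_norm_tendsto_zero]
    have h1 : Tendsto (fun y : V => |f ‖y‖|) (𝓝[s] 0) (𝓝 0) := by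
      simpa [h0] using (hfn 0 hx).abs.tendsto
    refine squeeze_zero (fun _ => norm_nonneg _) (fun y => ?_) h1
    rcases eq_or_ne y 0 with rfl | hy
    · simp
    have : ‖y‖ ≠ 0 := norm_ne_zero_iff.2 hy
    rw [radialMap, norm_smul, norm_div, norm_norm, Real.norm_eq_abs]
    field_simp
    exact le_rfl
  · exact ((hfn x hx).div continuous_norm.continuousWithinAt (norm_ne_zero_iff.2 hx0)).smul
      continuousWithinAt_id

end Radial

section RadialSmooth

variable {V : Type*} [NormedAddCommGroup V] [InnerProductSpace ℝ V]

theorem contDiffOn_radialMap {f : ℝ → ℝ} {s : Set V} {t : Set ℝ} (hst : MapsTo norm s t)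
    (hs : ∀ x ∈ s, x ≠ 0) (hf : ContDiffOn ℝ ∞ f t) : ContDiffOn ℝ ∞ (radialMap f) s := by
  have hn : ContDiffOn ℝ ∞ (fun x : V => ‖x‖) s := contDiffOn_id.norm ℝ hs
  exact ((hf.comp hn hst).div hn fun x hx => norm_ne_zero_iff.2 (hs x hx)).smul contDiffOn_id

end RadialSmooth

/-! ### Invariances and positivity of the lifted Fubini–Study form. -/

section HermitianForms

variable {n : ℕ}

theorem reInner_apply (x u : CSpace n) : reInner x u = (inner ℂ x u).re := rfl

theorem imInner_apply (x u : CSpace n) : imInner x u = (inner ℂ x u).im := rfl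

theorem sqForm_apply {E : Type*} [NormedAddCommGroup E] [NormedSpace ℝ E] (ℓ : E →L[ℝ] ℝ)
    (u v : E) : sqForm ℓ u v = ℓ u * ℓ v := by
  simp [sqForm]

theorem euclForm_apply (u v : CSpace n) : euclForm n u v = (inner ℂ u v).re := by
  simp only [euclForm, PiLp.inner_apply, Complex.re_sum]
  rfl

theorem fubiniStudyLift_apply (x u v : CSpace n) : fubiniStudyLift x u v =
    (‖x‖ ^ 2)⁻¹ * (inner ℂ u v).re - (‖x‖ ^ 4)⁻¹ *
      ((inner ℂ x u).re * (inner ℂ x v).re + (inner ℂ x u).im * (inner ℂ x v).im) := by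
  simp [fubiniStudyLift, euclForm_apply, sqForm_apply, reInner_apply, imInner_apply, mul_add]

theorem fubiniStudyLift_symm (x u v : CSpace n) :
    fubiniStudyLift x u v = fubiniStudyLift x v u := by
  rw [fubiniStudyLift_apply, fubiniStudyLift_apply, ← inner_conj_symm u v, Complex.conj_re]
  ring

theorem fubiniStudyLift_smul {t : ℂ} (ht : t ≠ 0) (x u v : CSpace n) :
    fubiniStudyLift (t • x) (t • u) (t • v) = fubiniStudyLift x u v := by
  rcases eq_or_ne x 0 with rfl | hx
  · simp [fubiniStudyLift_apply]
  have h1 : ‖t‖ ≠ 0 := norm_ne_zero_iff.2 ht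
  have h2 : ‖x‖ ≠ 0 := norm_ne_zero_iff.2 hx
  have h3 : ∀ z : ℂ, t * ((starRingEnd ℂ) t * z) = ((‖t‖ ^ 2 : ℝ) : ℂ) * z := fun z => by
    rw [← mul_assoc, Complex.mul_conj, Complex.normSq_eq_norm_sq]
  simp only [fubiniStudyLift_apply, inner_smul_left, inner_smul_right, norm_smul, h3,
    Complex.re_ofReal_mul, Complex.im_ofReal_mul]
  field_simp

theorem inner_self_re_im (x : CSpace n) : inner ℂ x x = ((‖x‖ ^ 2 : ℝ) : ℂ) := by
  rw [inner_self_eq_norm_sq_to_K]; norm_cast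

/-- The form pairs the components of `u` and `v` that are Hermitian-orthogonal to `x`, so the
complex line through `x` lies in its radical. -/
theorem fubiniStudyLift_add_smul (x u v : CSpace n) (a b : ℂ) :
    fubiniStudyLift x (u + a • x) (v + b • x) = fubiniStudyLift x u v := by
  rcases eq_or_ne x 0 with rfl | hx
  · simp
  have h2 : ‖x‖ ≠ 0 := norm_ne_zero_iff.2 hx
  simp only [fubiniStudyLift_apply, inner_add_left, inner_add_right, inner_smul_left,
    inner_smul_right, inner_self_re_im, ← inner_conj_symm u x, Complex.add_re, Complex.add_im,
    Complex.mul_re, Complex.mul_im, Complex.conj_re, Complex.conj_im, Complex.ofReal_re,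
    Complex.ofReal_im]
  field_simp
  ring

theorem fubiniStudyLift_smul_self_left (x v : CSpace n) (a : ℂ) :
    fubiniStudyLift x (a • x) v = 0 := by
  simpa using fubiniStudyLift_add_smul x 0 v a 0

/-- Cauchy–Schwarz for the Hermitian inner product. -/
theorem fubiniStudyLift_nonneg (x u : CSpace n) : 0 ≤ fubiniStudyLift x u u := by
  rcases eq_or_ne x 0 with rfl | hx
  · simp [fubiniStudyLift_apply]
  have h2 : 0 < ‖x‖ := norm_pos_iff.2 hx
  have h3 := norm_inner_le_norm (𝕜 := ℂ) x u
  have h4 : ‖inner ℂ x u‖ ^ 2 = (inner ℂ x u).re * (inner ℂ x u).re +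
      (inner ℂ x u).im * (inner ℂ x u).im := by
    rw [← Complex.normSq_eq_norm_sq, Complex.normSq_apply]
  have h5 : ‖inner ℂ x u‖ ^ 2 ≤ ‖x‖ ^ 2 * ‖u‖ ^ 2 := by
    rw [← mul_pow]; gcongr
  rw [fubiniStudyLift_apply, ← h4, inner_self_re_im, Complex.ofReal_re]
  have : (‖x‖ ^ 2)⁻¹ * ‖u‖ ^ 2 - (‖x‖ ^ 4)⁻¹ * ‖inner ℂ x u‖ ^ 2 =
      (‖x‖ ^ 4)⁻¹ * (‖x‖ ^ 2 * ‖u‖ ^ 2 - ‖inner ℂ x u‖ ^ 2) := by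
    field_simp
  rw [this]
  exact mul_nonneg (by positivity) (sub_nonneg.2 h5)

end HermitianForms

/-! ### The Fubini–Study metric in affine coordinates. -/

namespace CP

variable {m : ℕ}

/-- The linear part of `affineLift i`. -/
def affineIncl (i : Fin (m + 1)) : CSpace m →L[ℝ] CSpace (m + 1) :=
  LinearMap.toContinuousLinearMap
    { toFun := fun w => WithLp.toLp 2 (Fin.insertNth i 0 w.ofLp)
      map_add' := fun a b => by
        ext k
        rcases Fin.eq_self_or_eq_succAbove i k with rfl | ⟨j, rfl⟩ <;> simp
      map_smul' := fun t a => by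
        ext k
        rcases Fin.eq_self_or_eq_succAbove i k with rfl | ⟨j, rfl⟩ <;> simp }

@[simp] theorem affineIncl_same (i : Fin (m + 1)) (w : CSpace m) : affineIncl i w i = 0 := by
  simp [affineIncl]

@[simp] theorem affineIncl_succAbove (i : Fin (m + 1)) (w : CSpace m) (j : Fin m) :
    affineIncl i w (i.succAbove j) = w j := by
  simp [affineIncl]

theorem affineLift_eq (i : Fin (m + 1)) (w : CSpace m) :
    affineLift i w = affineIncl i w + affineLift i 0 := by
  ext k
  rcases Fin.eq_self_or_eq_succAbove i k with rfl | ⟨j, rfl⟩ <;> simp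

theorem hasFDerivAt_affineLift (i : Fin (m + 1)) (w : CSpace m) :
    HasFDerivAt (affineLift i) (affineIncl i) w := by
  have : affineLift i = fun w => affineIncl i w + affineLift i 0 := funext (affineLift_eq i)
  rw [this]
  exact (affineIncl i).hasFDerivAt.add_const _

theorem inner_affineIncl (i : Fin (m + 1)) (u v : CSpace m) :
    inner ℂ (affineIncl i u) (affineIncl i v) = inner ℂ u v := by
  simp [PiLp.inner_apply, Fin.sum_univ_succAbove _ i]

theorem inner_affineLift (i : Fin (m + 1)) (u v : CSpace m) :
    inner ℂ (affineLift i u) (affineIncl i v) = inner ℂ u v := by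
  simp [PiLp.inner_apply, Fin.sum_univ_succAbove _ i]

theorem norm_affineLift_sq (i : Fin (m + 1)) (w : CSpace m) :
    ‖affineLift i w‖ ^ 2 = 1 + ‖w‖ ^ 2 := by
  simp [EuclideanSpace.norm_sq_eq, Fin.sum_univ_succAbove _ i]

/-- The section `affineLift i` has derivative `affineIncl i`, so the coordinate form is the lifted
form pulled back by a section. The left side does not depend on `i`, so all affine charts share one
formula. -/
theorem fubiniStudyCoord_apply (i : Fin (m + 1)) (w u v : CSpace m) :
    fubiniStudyCoord w u v =
      fubiniStudyLift (affineLift i w) (affineIncl i u) (affineIncl i v) := by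
  rw [fubiniStudyLift_apply, inner_affineIncl, inner_affineLift, inner_affineLift,
    show (4 : ℕ) = 2 * 2 from rfl, pow_mul, norm_affineLift_sq]
  simp [fubiniStudyCoord, euclForm_apply, sqForm_apply, reInner_apply, imInner_apply, mul_add]

/-- The summand 1 in `1 + ‖w‖ ^ 2` leaves an extra `‖u‖ ^ 2` beyond Cauchy–Schwarz, whence strict
positivity. -/
theorem fubiniStudyCoord_pos (w : CSpace m) {u : CSpace m} (hu : u ≠ 0) :
    0 < fubiniStudyCoord w u u := by
  have h3 := norm_inner_le_norm (𝕜 := ℂ) w u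
  have h4 : ‖inner ℂ w u‖ ^ 2 = (inner ℂ w u).re * (inner ℂ w u).re +
      (inner ℂ w u).im * (inner ℂ w u).im := by
    rw [← Complex.normSq_eq_norm_sq, Complex.normSq_apply]
  have h5 : ‖inner ℂ w u‖ ^ 2 ≤ ‖w‖ ^ 2 * ‖u‖ ^ 2 := by
    rw [← mul_pow]; gcongr
  have h6 : 0 < ‖u‖ := norm_pos_iff.2 hu
  rw [fubiniStudyCoord_apply 0, fubiniStudyLift_apply, inner_affineIncl, inner_affineLift,
    show (4 : ℕ) = 2 * 2 from rfl, pow_mul, norm_affineLift_sq, ← h4, inner_self_re_im,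
    Complex.ofReal_re]
  have h7 : (0 : ℝ) < 1 + ‖w‖ ^ 2 := by positivity
  have : (1 + ‖w‖ ^ 2)⁻¹ * ‖u‖ ^ 2 - ((1 + ‖w‖ ^ 2) ^ 2)⁻¹ * ‖inner ℂ w u‖ ^ 2 =
      ((1 + ‖w‖ ^ 2) ^ 2)⁻¹ * (‖u‖ ^ 2 + (‖w‖ ^ 2 * ‖u‖ ^ 2 - ‖inner ℂ w u‖ ^ 2)) := by
    field_simp
    ring
  rw [this]
  have := sub_nonneg.2 h5
  positivity

theorem contDiff_fubiniStudyCoord : ContDiff ℝ ∞ (fubiniStudyCoord (m := m)) := by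
  have h7 : ∀ w : CSpace m, (1 + ‖w‖ ^ 2 : ℝ) ≠ 0 := fun w => by positivity
  have hn : ContDiff ℝ ∞ (fun w : CSpace m => 1 + ‖w‖ ^ 2) :=
    contDiff_const.add (contDiff_norm_sq ℝ)
  rw [contDiff_clm_apply_iff]
  intro u
  rw [contDiff_clm_apply_iff]
  intro v
  have hi : ∀ u : CSpace m, ContDiff ℝ ∞ (fun w : CSpace m => inner ℂ w u) := fun u =>
    contDiff_id.inner ℂ contDiff_const
  have hre : ∀ u : CSpace m, ContDiff ℝ ∞ (fun w : CSpace m => reInner w u) := fun u =>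
    Complex.reCLM.contDiff.comp (hi u)
  have him : ∀ u : CSpace m, ContDiff ℝ ∞ (fun w : CSpace m => imInner w u) := fun u =>
    Complex.imCLM.contDiff.comp (hi u)
  have := ((hn.inv h7).mul (contDiff_const (c := euclForm m u v))).sub
    (((hn.pow 2).inv fun w => pow_ne_zero 2 (h7 w)).mul
      (((hre u).mul (hre v)).add ((him u).mul (him v))))
  simpa [fubiniStudyCoord, sqForm_apply, mul_add] using this

/-- The affine coordinates of the line spanned by a vector. -/
def affineCoordVec (i : Fin (m + 1)) (x : CSpace (m + 1)) : CSpace m :=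
  WithLp.toLp 2 fun j => x (i.succAbove j) / x i

theorem contDiffAt_affineCoordVec {i : Fin (m + 1)} {x : CSpace (m + 1)} (hx : x i ≠ 0) :
    ContDiffAt ℝ ∞ (affineCoordVec i) x := by
  rw [contDiffAt_piLp 2]
  intro k
  have h : ∀ l : Fin (m + 1), ContDiff ℝ ∞ (fun w : CSpace (m + 1) => w l) := fun l =>
    contDiff_piLp_apply (𝕜 := ℝ) (E := fun _ : Fin (m + 1) => ℂ) (i := l) 2
  exact ((h _).contDiffAt.mul ((h _).contDiffAt.inv hx))

theorem smul_affineLift_affineCoordVec {i : Fin (m + 1)} {x : CSpace (m + 1)} (hx : x i ≠ 0) :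
    x i • affineLift i (affineCoordVec i x) = x := by
  ext k
  rcases Fin.eq_self_or_eq_succAbove i k with rfl | ⟨j, rfl⟩
  · simp
  · simp [affineCoordVec, mul_div_cancel₀ _ hx]

/-- Product rule applied to the identity of `smul_affineLift_affineCoordVec`. -/
theorem smul_affineIncl_fderiv {i : Fin (m + 1)} {x : CSpace (m + 1)} (hx : x i ≠ 0)
    (u : CSpace (m + 1)) :
    x i • affineIncl i (fderiv ℝ (affineCoordVec i) x u) = u + (-(u i / x i)) • x := by
  have hl : HasFDerivAt (fun y : CSpace (m + 1) => y i)
      ((EuclideanSpace.proj i : CSpace (m + 1) →L[ℂ] ℂ).restrictScalars ℝ) x :=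
    ((EuclideanSpace.proj i : CSpace (m + 1) →L[ℂ] ℂ).restrictScalars ℝ).hasFDerivAt
  have hd := ((contDiffAt_affineCoordVec hx).differentiableAt (by simp)).hasFDerivAt
  have h1 := hl.smul ((hasFDerivAt_affineLift i (affineCoordVec i x)).comp x hd)
  have hn : ∀ᶠ y in 𝓝 x, y i ≠ 0 :=
    (hl.continuousAt).eventually_ne hx
  have h2 : HasFDerivAt (fun y : CSpace (m + 1) => y i • affineLift i (affineCoordVec i y))
      (ContinuousLinearMap.id ℝ _) x :=
    (hasFDerivAt_id x).congr_of_eventuallyEq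
      (hn.mono fun y hy => smul_affineLift_affineCoordVec hy)
  have h3 := congrArg (fun T : CSpace (m + 1) →L[ℝ] CSpace (m + 1) => T u) (h1.unique h2)
  have h4 : affineLift i (affineCoordVec i x) = (x i)⁻¹ • x := by
    rw [eq_inv_smul_iff₀ hx, smul_affineLift_affineCoordVec hx]
  have h5 : x i • affineIncl i (fderiv ℝ (affineCoordVec i) x u) + u i • (x i)⁻¹ • x = u := by
    simpa [h4] using h3
  rw [eq_sub_of_add_eq h5, smul_smul, neg_smul, div_eq_mul_inv, sub_eq_add_neg]

/-- After rescaling by `x i`, the base point is `x` and the vectors are `u`, `v` up to complex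
multiples of `x`; the lifted form ignores both changes. -/
theorem fubiniStudyCoord_fderiv {i : Fin (m + 1)} {x : CSpace (m + 1)} (hx : x i ≠ 0)
    (u v : CSpace (m + 1)) :
    fubiniStudyCoord (affineCoordVec i x) (fderiv ℝ (affineCoordVec i) x u)
      (fderiv ℝ (affineCoordVec i) x v) = fubiniStudyLift x u v := by
  rw [fubiniStudyCoord_apply i, ← fubiniStudyLift_smul hx, smul_affineLift_affineCoordVec hx,
    smul_affineIncl_fderiv hx, smul_affineIncl_fderiv hx, fubiniStudyLift_add_smul]

end CP

/-! ### The map from a vector to its complex line, and its differential. -/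

section HopfMap

variable {m : ℕ}

/-- The complex line spanned by a vector (arbitrary for the zero vector). -/
def hopfLine (x : CSpace (m + 1)) : CP m := (hopfProj x).2

theorem hopfLine_of_ne {x : CSpace (m + 1)} (hx : x ≠ 0) :
    hopfLine x = Projectivization.mk ℂ x hx := by
  simp [hopfLine, hopfProj, hx]

theorem hopfProj_eq (x : CSpace (m + 1)) : hopfProj x = (‖x‖, hopfLine x) := rfl

theorem hopfLine_mem_affineDomain {i : Fin (m + 1)} {x : CSpace (m + 1)} (hx : x ≠ 0) :
    hopfLine x ∈ CP.affineDomain i ↔ x i ≠ 0 := by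
  rw [hopfLine_of_ne hx, CP.mem_affineDomain_mk]

theorem affineChart_hopfLine (i : Fin (m + 1)) {x : CSpace (m + 1)} (hx : x ≠ 0) :
    CP.affineChart i (hopfLine x) = CP.affineCoordVec i x := by
  rw [hopfLine_of_ne hx]
  exact CP.affineCoord_mk i x hx

theorem hopfLine_smul {t : ℂ} (ht : t ≠ 0) {x : CSpace (m + 1)} (hx : x ≠ 0) :
    hopfLine (t • x) = hopfLine x := by
  rw [hopfLine_of_ne hx, hopfLine_of_ne (smul_ne_zero ht hx), Projectivization.mk_eq_mk_iff']
  exact ⟨t, rfl⟩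

theorem hopfLine_affineLift (i : Fin (m + 1)) (w : CSpace m) :
    hopfLine (CP.affineLift i w) = (CP.affineChart i).symm w :=
  hopfLine_of_ne (CP.affineLift_ne_zero i w)

theorem affineChart_mem_maximalAtlas (i : Fin (m + 1)) :
    CP.affineChart i ∈ IsManifold.maximalAtlas 𝓘(ℝ, CSpace m) ∞ (CP m) :=
  IsManifold.subset_maximalAtlas (mem_range_self i)

theorem contMDiff_affineChart_symm (i : Fin (m + 1)) :
    ContMDiff 𝓘(ℝ, CSpace m) 𝓘(ℝ, CSpace m) ∞ (CP.affineChart i).symm :=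
  contMDiffOn_univ.1 (contMDiffOn_symm_of_mem_maximalAtlas (affineChart_mem_maximalAtlas i))

theorem hopfLine_eventuallyEq {i : Fin (m + 1)} {x : CSpace (m + 1)} (hx : x i ≠ 0) :
    hopfLine =ᶠ[𝓝 x] (CP.affineChart i).symm ∘ CP.affineCoordVec i := by
  have hc : ContinuousAt (fun y : CSpace (m + 1) => y i) x := by fun_prop
  filter_upwards [hc.eventually_ne hx] with y hy
  have hy0 : y ≠ 0 := by rintro rfl; simp at hy
  rw [Function.comp_apply, ← affineChart_hopfLine i hy0, OpenPartialHomeomorph.left_inv]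
  exact (hopfLine_mem_affineDomain hy0).2 hy

theorem exists_coord_ne_zero {x : CSpace (m + 1)} (hx : x ≠ 0) : ∃ i, x i ≠ 0 := by
  by_contra! h
  exact hx (by ext i; exact h i)

theorem contMDiffAt_hopfLine {x : CSpace (m + 1)} (hx : x ≠ 0) :
    ContMDiffAt 𝓘(ℝ, CSpace (m + 1)) 𝓘(ℝ, CSpace m) ∞ hopfLine x := by
  obtain ⟨i, hi⟩ := exists_coord_ne_zero hx
  refine ContMDiffAt.congr_of_eventuallyEq ?_ (hopfLine_eventuallyEq hi)
  exact (contMDiff_affineChart_symm i _).comp x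
    (CP.contDiffAt_affineCoordVec hi).contMDiffAt

theorem mdifferentiableAt_hopfLine {x : CSpace (m + 1)} (hx : x ≠ 0) :
    MDifferentiableAt 𝓘(ℝ, CSpace (m + 1)) 𝓘(ℝ, CSpace m) hopfLine x :=
  (contMDiffAt_hopfLine hx).mdifferentiableAt (by simp)

theorem formEval_fubiniStudy (L : CP m) (u v : CSpace m) :
    formEval 𝓘(ℝ, CSpace m) (CP.fubiniStudy m) L u v =
      CP.fubiniStudyCoord (chartAt (CSpace m) L L)
        (modelDeriv 𝓘(ℝ, CSpace m) 𝓘(ℝ, CSpace m) (chartAt (CSpace m) L) L u)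
        (modelDeriv 𝓘(ℝ, CSpace m) 𝓘(ℝ, CSpace m) (chartAt (CSpace m) L) L v) := by
  have h : formEval 𝓘(ℝ, CSpace m) (CP.fubiniStudy m) L u v =
      formEval 𝓘(ℝ, CSpace m) (pullbackForm 𝓘(ℝ, CSpace m) 𝓘(ℝ, CSpace m)
        (chartAt (CSpace m) L) CP.fubiniStudyCoord) L u v := by
    unfold formEval CP.fubiniStudy
    with_reducible rfl
  exact h.trans (formEval_pullbackForm_vectorSpace _ _ _ _ _ _)

/-- The Fubini-Study metric pulls back to `fubiniStudyLift` under `x ↦ [x]`. -/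
theorem fubiniStudy_hopfLine {x : CSpace (m + 1)} (hx : x ≠ 0) (u v : CSpace (m + 1)) :
    formEval 𝓘(ℝ, CSpace m) (CP.fubiniStudy m) (hopfLine x)
      (modelDeriv 𝓘(ℝ, CSpace (m + 1)) 𝓘(ℝ, CSpace m) hopfLine x u)
      (modelDeriv 𝓘(ℝ, CSpace (m + 1)) 𝓘(ℝ, CSpace m) hopfLine x v) = fubiniStudyLift x u v := by
  set L := hopfLine x with hL
  -- `fubiniStudy` uses the preferred chart at each point, which may jump; all that matters is that
  -- it is some affine chart.
  obtain ⟨i, hi⟩ : ∃ i, chartAt (CSpace m) L = CP.affineChart i := by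
    obtain ⟨i, hi⟩ := chart_mem_atlas (CSpace m) L
    exact ⟨i, hi.symm⟩
  have hxi : x i ≠ 0 := by
    have := mem_chart_source (CSpace m) L
    rw [hi] at this
    exact (hopfLine_mem_affineDomain hx).1 this
  have hch : MDifferentiableAt 𝓘(ℝ, CSpace m) 𝓘(ℝ, CSpace m) (CP.affineChart i) L :=
    mdifferentiableAt_atlas (mem_range_self i) ((hopfLine_mem_affineDomain hx).2 hxi)
  have he : CP.affineChart i ∘ hopfLine =ᶠ[𝓝 x] CP.affineCoordVec i := by
    filter_upwards [isOpen_ne.mem_nhds hx] with y hy using affineChart_hopfLine i hy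
  have h2 := modelDeriv_comp 𝓘(ℝ, CSpace (m + 1)) 𝓘(ℝ, CSpace m) 𝓘(ℝ, CSpace m)
    (f := hopfLine) (f' := CP.affineChart i) (x := x) hch (mdifferentiableAt_hopfLine hx)
  rw [modelDeriv_congr _ _ he, modelDeriv_vectorSpace] at h2
  rw [formEval_fubiniStudy, hi, ← CP.fubiniStudyCoord_fderiv hxi, h2,
    ← affineChart_hopfLine i hx]
  rfl

theorem fubiniStudy_symm (L : CP m) (u v : CSpace m) :
    formEval 𝓘(ℝ, CSpace m) (CP.fubiniStudy m) L u v =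
      formEval 𝓘(ℝ, CSpace m) (CP.fubiniStudy m) L v u := by
  have : ∀ w a b : CSpace m, CP.fubiniStudyCoord w a b = CP.fubiniStudyCoord w b a := by
    intro w a b
    rw [CP.fubiniStudyCoord_apply 0, fubiniStudyLift_symm, ← CP.fubiniStudyCoord_apply]
  rw [formEval_fubiniStudy, formEval_fubiniStudy, this]

theorem fubiniStudy_pos (L : CP m) {u : CSpace m} (hu : u ≠ 0) :
    0 < formEval 𝓘(ℝ, CSpace m) (CP.fubiniStudy m) L u u := by
  rw [formEval_fubiniStudy]
  refine CP.fubiniStudyCoord_pos _ fun h => hu ?_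
  have hm := mdifferentiable_of_mem_atlas (I := 𝓘(ℝ, CSpace m)) (chart_mem_atlas (CSpace m) L)
  exact (hm.mfderiv_injective (mem_chart_source _ L)) (h.trans (map_zero _).symm)

/-- A nonzero image would have positive Fubini–Study length, whereas the lifted form vanishes on the
complex line of `x`. -/
theorem modelDeriv_hopfLine_smul {x : CSpace (m + 1)} (hx : x ≠ 0) (a : ℂ) :
    modelDeriv 𝓘(ℝ, CSpace (m + 1)) 𝓘(ℝ, CSpace m) hopfLine x (a • x) = 0 := by
  by_contra h
  have := fubiniStudy_pos (hopfLine x) h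
  rw [fubiniStudy_hopfLine hx, fubiniStudyLift_smul_self_left] at this
  exact this.false

theorem surjective_modelDeriv_hopfLine {x : CSpace (m + 1)} (hx : x ≠ 0) :
    Function.Surjective (modelDeriv 𝓘(ℝ, CSpace (m + 1)) 𝓘(ℝ, CSpace m) hopfLine x) := by
  obtain ⟨i, hi⟩ := exists_coord_ne_zero hx
  set L := hopfLine x with hL
  have hLi : L ∈ CP.affineDomain i := (hopfLine_mem_affineDomain hx).2 hi
  -- A local section through `x` itself: differentiating `hopfLine ∘ σ = id` gives a right inverse
  -- of the differential at `x`.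
  let σ : CP m → CSpace (m + 1) := fun L => x i • CP.affineLift i (CP.affineChart i L)
  have hσx : σ L = x := by
    change x i • CP.affineLift i (CP.affineChart i (hopfLine x)) = x
    rw [affineChart_hopfLine i hx, CP.smul_affineLift_affineCoordVec hi]
  have hch : MDifferentiableAt 𝓘(ℝ, CSpace m) 𝓘(ℝ, CSpace m) (CP.affineChart i) L :=
    mdifferentiableAt_atlas (mem_range_self i) hLi
  have hσ : MDifferentiableAt 𝓘(ℝ, CSpace m) 𝓘(ℝ, CSpace (m + 1)) σ L := by
    have h1 : DifferentiableAt ℝ (fun w : CSpace m => x i • CP.affineLift i w)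
        (CP.affineChart i L) :=
      (CP.hasFDerivAt_affineLift i _).differentiableAt.const_smul (x i)
    exact h1.mdifferentiableAt.comp L hch
  have hid : hopfLine ∘ σ =ᶠ[𝓝 L] id := by
    filter_upwards [(CP.isOpen_affineDomain i).mem_nhds hLi] with L' hL'
    change hopfLine (x i • CP.affineLift i (CP.affineChart i L')) = L'
    rw [hopfLine_smul hi (CP.affineLift_ne_zero i _), hopfLine_affineLift]
    exact (CP.affineChart i).left_inv hL'
  have hh : MDifferentiableAt 𝓘(ℝ, CSpace (m + 1)) 𝓘(ℝ, CSpace m) hopfLine (σ L) := by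
    rw [hσx]; exact mdifferentiableAt_hopfLine hx
  have hcomp := modelDeriv_comp 𝓘(ℝ, CSpace m) 𝓘(ℝ, CSpace (m + 1)) 𝓘(ℝ, CSpace m) hh hσ
  rw [modelDeriv_congr _ _ hid, hσx] at hcomp
  have h2 : modelDeriv 𝓘(ℝ, CSpace m) 𝓘(ℝ, CSpace m) (id : CP m → CP m) L =
      ContinuousLinearMap.id ℝ (CSpace m) := mfderiv_id
  intro v
  refine ⟨modelDeriv 𝓘(ℝ, CSpace m) 𝓘(ℝ, CSpace (m + 1)) σ L v, ?_⟩
  rw [h2] at hcomp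
  exact (congrArg (fun T : CSpace m →L[ℝ] CSpace m => T v) hcomp).symm

/-- The coefficients of the Fubini-Study metric in the affine charts. -/
theorem fubiniStudy_affineChart_symm (i : Fin (m + 1)) (w u v : CSpace m) :
    formEval 𝓘(ℝ, CSpace m) (pullbackForm 𝓘(ℝ, CSpace m) 𝓘(ℝ, CSpace m)
      (CP.affineChart i).symm (CP.fubiniStudy m)) w u v = CP.fubiniStudyCoord w u v := by
  have h1 : ((CP.affineChart i).symm : CSpace m → CP m) = hopfLine ∘ CP.affineLift i :=
    funext fun w => (hopfLine_affineLift i w).symm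
  have h0 := CP.affineLift_ne_zero i w
  have hd := CP.hasFDerivAt_affineLift i w
  rw [h1, formEval_pullbackForm_comp _ 𝓘(ℝ, CSpace (m + 1)) _ _ (mdifferentiableAt_hopfLine h0)
    hd.differentiableAt.mdifferentiableAt, formEval_pullbackForm, fubiniStudy_hopfLine h0,
    modelDeriv_vectorSpace, hd.fderiv, CP.fubiniStudyCoord_apply i]

end HopfMap

/-! ### Closed form, bounds and rescaling of $Q_k$. -/

section PolyQ

/-- Binomial expansion and termwise integration of $t^{2j-2}$. The exponent is even, hence never
$-1$, and no logarithm appears; the lower endpoint contributes the $-s$. -/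
theorem polyQ_eq_sum (k : ℕ) {s : ℝ} (hs : 1 ≤ s) : polyQ k s =
    ∑ j ∈ Finset.range (k + 1),
      ((-1) ^ (k - j) * (k.choose j : ℝ) / (2 * (j : ℝ) - 1)) * (s ^ (2 * j) - s) := by
  have h0 : (0 : ℝ) ∉ uIcc 1 s := by
    rw [uIcc_of_le hs]; intro h; linarith [h.1]
  have hs0 : s ≠ 0 := by positivity
  have h1 : EqOn (fun t : ℝ => (t ^ 2)⁻¹ * (t ^ 2 - 1) ^ k)
      (fun t => ∑ j ∈ Finset.range (k + 1),
        ((-1) ^ (k - j) * (k.choose j : ℝ)) * t ^ (2 * (j : ℤ) - 2)) (uIcc 1 s) := by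
    intro t ht
    have ht0 : t ≠ 0 := by rintro rfl; exact h0 ht
    dsimp only
    rw [sub_eq_add_neg, add_pow, Finset.mul_sum]
    refine Finset.sum_congr rfl fun j _ => ?_
    have h : t ^ (2 * (j : ℤ) - 2) = t ^ (2 * j) / t ^ 2 := by
      rw [zpow_sub₀ ht0]; norm_cast
    rw [h, ← pow_mul]
    ring
  have hii : ∀ j ∈ Finset.range (k + 1), IntervalIntegrable
      (fun t : ℝ => ((-1) ^ (k - j) * (k.choose j : ℝ)) * t ^ (2 * (j : ℤ) - 2))
      MeasureTheory.volume 1 s := fun j _ =>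
    (intervalIntegral.intervalIntegrable_zpow (Or.inr h0)).const_mul _
  rw [polyQ, intervalIntegral.integral_congr h1, intervalIntegral.integral_finsetSum hii,
    Finset.mul_sum]
  refine Finset.sum_congr rfl fun j _ => ?_
  have h2 : (2 * (j : ℤ) - 2) ≠ -1 := by omega
  have h3 : (2 * (j : ℝ) - 1) ≠ 0 := by
    intro h
    have : (2 * (j : ℤ) - 1) = 0 := by exact_mod_cast h
    omega
  rw [intervalIntegral.integral_const_mul, integral_zpow (Or.inr ⟨h2, h0⟩),
    show (2 * (j : ℤ) - 2 + 1) = 2 * (j : ℤ) - 1 by ring, zpow_sub₀ hs0, one_zpow,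
    show ((2 * (j : ℤ) - 2 : ℤ) : ℝ) + 1 = 2 * (j : ℝ) - 1 by push_cast; ring]
  rw [show s ^ (2 * (j : ℤ)) = s ^ (2 * j) by norm_cast, zpow_one]
  field_simp

theorem continuousOn_polyQ_integrand (k : ℕ) {s : ℝ} :
    ContinuousOn (fun t : ℝ => (t ^ 2)⁻¹ * (t ^ 2 - 1) ^ k) (Icc 1 s) := by
  refine ContinuousOn.mul (ContinuousOn.inv₀ (by fun_prop) fun t ht => ?_) (by fun_prop)
  have : 0 < t := lt_of_lt_of_le one_pos ht.1
  positivity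

theorem polyQ_pos (k : ℕ) {s : ℝ} (hs : 1 < s) : 0 < polyQ k s := by
  refine mul_pos (by linarith) (intervalIntegral.intervalIntegral_pos_of_pos_on
    ((continuousOn_polyQ_integrand k).intervalIntegrable_of_Icc hs.le) (fun t ht => ?_) hs)
  have h1 : 0 < t ^ 2 - 1 := by nlinarith [ht.1]
  have : 0 < t := lt_trans one_pos ht.1
  positivity

/-- Replace $(t^2-1)^k$ by its value at the endpoint $s$; what remains is $Q_0(s)=s-1$. -/
theorem polyQ_le (k : ℕ) {s : ℝ} (hs : 1 ≤ s) : polyQ k s ≤ (s ^ 2 - 1) ^ k * (s - 1) := by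
  have hs0 : 0 < s := by linarith
  have h0 : (0 : ℝ) ∉ uIcc 1 s := by
    rw [uIcc_of_le hs]; intro h; linarith [h.1]
  have h2 : polyQ 0 s = s - 1 := by
    rw [polyQ_eq_sum 0 hs]; norm_num
  have h3 : (∫ t in (1 : ℝ)..s, (t ^ 2)⁻¹ * (t ^ 2 - 1) ^ k) ≤
      ∫ t in (1 : ℝ)..s, (s ^ 2 - 1) ^ k * ((t ^ 2)⁻¹ * (t ^ 2 - 1) ^ 0) := by
    refine intervalIntegral.integral_mono_on hs
      ((continuousOn_polyQ_integrand k).intervalIntegrable_of_Icc hs)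
      (((continuousOn_polyQ_integrand 0).intervalIntegrable_of_Icc hs).const_mul _) fun t ht => ?_
    have h4 : 0 ≤ t ^ 2 - 1 := by nlinarith [ht.1]
    have h5 : t ^ 2 - 1 ≤ s ^ 2 - 1 := by nlinarith [ht.1, ht.2]
    rw [pow_zero, mul_one, mul_comm]
    gcongr
  rw [intervalIntegral.integral_const_mul] at h3
  rw [← h2]
  calc polyQ k s ≤ s * ((s ^ 2 - 1) ^ k * ∫ t in (1 : ℝ)..s, (t ^ 2)⁻¹ * (t ^ 2 - 1) ^ 0) :=
        mul_le_mul_of_nonneg_left h3 hs0.le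
    _ = (s ^ 2 - 1) ^ k * polyQ 0 s := by rw [polyQ]; ring

/-- The rescaling `ε^{2k} Q_k(√(1 + X / ε²))`, extended to `ε = 0`. -/
def scaledQ (k : ℕ) (ε X : ℝ) : ℝ :=
  ∑ j ∈ Finset.range (k + 1), ((-1) ^ (k - j) * (k.choose j : ℝ) / (2 * (j : ℝ) - 1)) *
    (ε ^ (2 * (k - j)) * (ε ^ 2 + X) ^ j - ε ^ (2 * k - 1) * √(ε ^ 2 + X))

/-- With $S=\sqrt{1+X/\varepsilon^2}$ one has $\varepsilon^2+X=(\varepsilon S)^2$, so the closed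
form matches term by term. The odd power $\varepsilon^{2k-1}$ is why the parameter is $\sqrt c$ and
not $c$; `hk` keeps this exponent from being truncated. -/
theorem scaledQ_eq {k : ℕ} (hk : 1 ≤ k) {ε X : ℝ} (hε : 0 < ε) (hX : 0 ≤ X) :
    scaledQ k ε X = (ε ^ 2) ^ k * polyQ k √(1 + X / ε ^ 2) := by
  set S := √(1 + X / ε ^ 2) with hS
  have hX' : 0 ≤ X / ε ^ 2 := by positivity
  have hS1 : 1 ≤ S := by rw [hS, Real.one_le_sqrt]; linarith
  have hS2 : ε ^ 2 + X = (ε * S) ^ 2 := by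
    rw [mul_pow, hS, Real.sq_sqrt (by positivity)]; field_simp
  rw [polyQ_eq_sum k hS1, Finset.mul_sum, scaledQ]
  refine Finset.sum_congr rfl fun j hj => ?_
  have hjk : j ≤ k := Nat.lt_succ_iff.1 (Finset.mem_range.1 hj)
  rw [hS2, Real.sqrt_sq (by positivity)]
  have e1 : ε ^ (2 * (k - j)) * ((ε * S) ^ 2) ^ j = (ε ^ 2) ^ k * S ^ (2 * j) := by
    rw [← pow_mul, mul_pow, ← mul_assoc, ← pow_add, ← pow_mul]
    congr 2; omega
  have e2 : ε ^ (2 * k - 1) * (ε * S) = (ε ^ 2) ^ k * S := by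
    rw [← mul_assoc, ← pow_succ, ← pow_mul]
    congr 2; omega
  rw [e1, e2]
  ring

/-- Only the term $j=k$ carries no positive power of $\varepsilon$ in front of
$(\varepsilon^2+X)^j$. -/
theorem scaledQ_zero {k : ℕ} (hk : 1 ≤ k) (X : ℝ) :
    scaledQ k 0 X = X ^ k / (2 * (k : ℝ) - 1) := by
  have h1 : (0 : ℝ) ^ (2 * k - 1) = 0 := zero_pow (by omega)
  rw [scaledQ, Finset.sum_range_succ, Finset.sum_eq_zero]
  · simp [h1]; ring
  · intro j hj
    have : j < k := Finset.mem_range.1 hj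
    rw [h1, zero_pow (by omega)]
    simp

theorem contDiffOn_scaledQ (k : ℕ) : ContDiffOn ℝ ∞ (fun z : ℝ × ℝ => scaledQ k z.1 z.2)
    {z | 0 < z.1 ^ 2 + z.2} := by
  unfold scaledQ
  refine ContDiffOn.sum fun j _ => contDiffOn_const.mul (ContDiffOn.sub ?_ ?_)
  · exact ContDiff.contDiffOn (by fun_prop)
  · refine ContDiffOn.mul (ContDiff.contDiffOn (by fun_prop)) (ContDiffOn.sqrt
      (ContDiff.contDiffOn (by fun_prop)) fun z hz => (ne_of_gt hz))

end PolyQ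

/-! ### The metric coefficients in the new radial coordinate and their behaviour as $c\to 0$. -/

section Coefficients

/-- The constant `2n / (2n - 3)`. -/
def coneConst (n : ℕ) : ℝ := 2 * (n : ℝ) / (2 * (n : ℝ) - 3)

theorem coneConst_pos {n : ℕ} (hn : 2 ≤ n) : 0 < coneConst n := by
  have : (2 : ℝ) ≤ n := by exact_mod_cast hn
  exact div_pos (by linarith) (by linarith)

/-- The coefficient `(2n / (2n - 3)) sinh² r` of the limit metric. -/
def coneCoeff (n : ℕ) (r : ℝ) : ℝ := coneConst n * Real.sinh r ^ 2

theorem coneCoeff_pos {n : ℕ} (hn : 2 ≤ n) {r : ℝ} (hr : 0 < r) : 0 < coneCoeff n r :=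
  mul_pos (coneConst_pos hn) (pow_pos (Real.sinh_pos_iff.2 hr) 2)

theorem coneCoeff_nonneg {n : ℕ} (hn : 2 ≤ n) (r : ℝ) : 0 ≤ coneCoeff n r :=
  mul_nonneg (coneConst_pos hn).le (sq_nonneg _)

theorem contDiff_coneCoeff (n : ℕ) : ContDiff ℝ ∞ (coneCoeff n) :=
  contDiff_const.mul (Real.contDiff_sinh.pow 2)

/-- The rescaling `c^n P_n(√(1 + X / c))`, `c = ε²`, extended to `ε = 0`. -/
def scaledP (n : ℕ) (ε X : ℝ) : ℝ :=
  (2 * (n : ℝ) - 1) * scaledQ n ε X + 2 * (n : ℝ) * scaledQ (n - 1) ε X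

theorem polyP_pos {n : ℕ} (hn : 2 ≤ n) {c s : ℝ} (hc : 0 < c) (hs : 1 < s) : 0 < polyP n c s := by
  have : (2 : ℝ) ≤ n := by exact_mod_cast hn
  have h1 := polyQ_pos n hs
  have h2 := polyQ_pos (n - 1) hs
  have h3 : 0 < 2 * (n : ℝ) - 1 := by linarith
  rw [polyP]
  positivity

theorem polyP_le {n : ℕ} (hn : 2 ≤ n) {c s : ℝ} (hc : 0 < c) (hs : 1 ≤ s) :
    polyP n c s ≤ (s ^ 2 - 1) ^ (n - 1) *
      (((2 * (n : ℝ) - 1) * (s ^ 2 - 1) + 2 * (n : ℝ) * c⁻¹) * (s - 1)) := by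
  have : (2 : ℝ) ≤ n := by exact_mod_cast hn
  have h3 : 0 ≤ 2 * (n : ℝ) - 1 := by linarith
  calc polyP n c s ≤ (2 * (n : ℝ) - 1) * ((s ^ 2 - 1) ^ n * (s - 1)) +
        2 * (n : ℝ) * c⁻¹ * ((s ^ 2 - 1) ^ (n - 1) * (s - 1)) := by
        rw [polyP]
        gcongr
        · exact polyQ_le n hs
        · exact polyQ_le (n - 1) hs
    _ = _ := by
        obtain ⟨k, rfl⟩ : ∃ k, n = k + 1 := ⟨n - 1, by omega⟩
        rw [Nat.add_sub_cancel, pow_succ]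
        ring

theorem scaledP_eq {n : ℕ} (hn : 2 ≤ n) {c X : ℝ} (hc : 0 < c) (hX : 0 ≤ X) :
    scaledP n √c X = c ^ n * polyP n c √(1 + X / c) := by
  have hs := Real.sqrt_pos.2 hc
  rw [scaledP, scaledQ_eq (by omega) hs hX, scaledQ_eq (by omega) hs hX, Real.sq_sqrt hc.le, polyP]
  obtain ⟨k, rfl⟩ : ∃ k, n = k + 1 := ⟨n - 1, by omega⟩
  rw [Nat.add_sub_cancel, pow_succ]
  field_simp

/-- The limits of the two summands of $P$ are $X^n$ and $\frac{2n}{2n-3}X^{n-1}$; this is the origin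
of the constant in $g_0$. -/
theorem scaledP_zero {n : ℕ} (hn : 2 ≤ n) (X : ℝ) :
    scaledP n 0 X = X ^ (n - 1) * (X + coneConst n) := by
  have h2 : (2 : ℝ) ≤ n := by exact_mod_cast hn
  have h3 : 2 * (n : ℝ) - 1 ≠ 0 := by intro h; linarith
  have h4 : 2 * (n : ℝ) - 3 ≠ 0 := by intro h; linarith
  rw [scaledP, scaledQ_zero (by omega), scaledQ_zero (by omega), coneConst]
  obtain ⟨k, rfl⟩ : ∃ k, n = k + 1 := ⟨n - 1, by omega⟩
  have h5 : 2 * ((k : ℝ) + 1) - 3 = 2 * (k : ℝ) - 1 := by ring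
  push_cast at *
  rw [h5] at *
  rw [pow_succ]
  field_simp

/-- The coefficient of `dr²` in the quotient metric, as a function of `ε = √c` and `r`. -/
def radialCoeff (n : ℕ) (ε r : ℝ) : ℝ :=
  coneCoeff n r ^ n * (coneConst n * Real.cosh r ^ 2) /
    ((ε ^ 2 + coneCoeff n r) * scaledP n ε (coneCoeff n r))

/-- The choice of $\sinh$ pays off here: $\kappa\sinh^2 r+\kappa=\kappa\cosh^2 r$ cancels the factor
produced by $(ds/dr)^2$. -/
theorem radialCoeff_zero {n : ℕ} (hn : 2 ≤ n) {r : ℝ} (hr : 0 < r) : radialCoeff n 0 r = 1 := by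
  have h1 := coneCoeff_pos hn hr
  have h2 : coneCoeff n r + coneConst n = coneConst n * Real.cosh r ^ 2 := by
    rw [coneCoeff, Real.cosh_sq]; ring
  have h3 : 0 < coneConst n * Real.cosh r ^ 2 :=
    mul_pos (coneConst_pos hn) (pow_pos (Real.cosh_pos r) 2)
  rw [radialCoeff, scaledP_zero hn, h2]
  obtain ⟨k, rfl⟩ : ∃ k, n = k + 1 := ⟨n - 1, by omega⟩
  have h4 := coneConst_pos hn
  rw [Nat.add_sub_cancel, pow_succ]
  field_simp
  ring

theorem scaledP_pos {n : ℕ} (hn : 2 ≤ n) {c X : ℝ} (hc : 0 < c) (hX : 0 < X) :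
    0 < scaledP n √c X := by
  rw [scaledP_eq hn hc hX.le]
  have : 0 < X / c := div_pos hX hc
  exact mul_pos (pow_pos hc n) (polyP_pos hn hc (Real.lt_sqrt_of_sq_lt (by linarith)))

theorem radialCoeff_pos {n : ℕ} (hn : 2 ≤ n) {c r : ℝ} (hc : 0 < c) (hr : 0 < r) :
    0 < radialCoeff n √c r := by
  have h1 := coneCoeff_pos hn hr
  have h2 := scaledP_pos hn hc h1
  have h3 := coneConst_pos hn
  have h4 := Real.cosh_pos r
  have h5 := Real.sqrt_pos.2 hc
  rw [radialCoeff]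
  positivity

theorem contDiffOn_scaledP_coneCoeff {n : ℕ} (hn : 2 ≤ n) :
    ContDiffOn ℝ ∞ (fun z : ℝ × ℝ => scaledP n z.1 (coneCoeff n z.2)) {z | 0 < z.2} := by
  have hm : MapsTo (fun z : ℝ × ℝ => (z.1, coneCoeff n z.2)) {z | 0 < z.2}
      {z | 0 < z.1 ^ 2 + z.2} := fun z hz =>
    add_pos_of_nonneg_of_pos (sq_nonneg _) (coneCoeff_pos hn hz)
  have hd : ContDiffOn ℝ ∞ (fun z : ℝ × ℝ => (z.1, coneCoeff n z.2)) {z | 0 < z.2} :=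
    (contDiff_fst.prodMk ((contDiff_coneCoeff n).comp contDiff_snd)).contDiffOn
  exact (contDiffOn_const.mul ((contDiffOn_scaledQ n).comp hd hm)).add
    (contDiffOn_const.mul ((contDiffOn_scaledQ (n - 1)).comp hd hm))

/-- The set of parameters for which `radialCoeff` is smooth. -/
def radialDomain (n : ℕ) : Set (ℝ × ℝ) :=
  {z | 0 < z.2} ∩ (fun z : ℝ × ℝ => scaledP n z.1 (coneCoeff n z.2)) ⁻¹' {0}ᶜ

theorem isOpen_radialDomain {n : ℕ} (hn : 2 ≤ n) : IsOpen (radialDomain n) :=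
  (contDiffOn_scaledP_coneCoeff hn).continuousOn.isOpen_inter_preimage
    (isOpen_lt continuous_const continuous_snd) isOpen_compl_singleton

theorem contDiffOn_radialCoeff {n : ℕ} (hn : 2 ≤ n) :
    ContDiffOn ℝ ∞ (fun z : ℝ × ℝ => radialCoeff n z.1 z.2) (radialDomain n) := by
  have h1 : ContDiff ℝ ∞ (fun z : ℝ × ℝ => coneCoeff n z.2) :=
    (contDiff_coneCoeff n).comp contDiff_snd
  have h2 : ContDiff ℝ ∞ (fun z : ℝ × ℝ => Real.cosh z.2) := Real.contDiff_cosh.comp contDiff_snd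
  refine ContDiffOn.div (((h1.pow n).mul (contDiff_const.mul (h2.pow 2))).contDiffOn)
    ((((contDiff_fst.pow 2).add h1).contDiffOn).mul
      ((contDiffOn_scaledP_coneCoeff hn).mono inter_subset_left)) fun z hz => ?_
  exact mul_ne_zero (ne_of_gt (add_pos_of_nonneg_of_pos (sq_nonneg _) (coneCoeff_pos hn hz.1))) hz.2

/-- The limit parameter $\varepsilon=0$ is interior to the domain of smoothness, so convergence
needs no separate estimates. -/
theorem zero_mem_radialDomain {n : ℕ} (hn : 2 ≤ n) {r : ℝ} (hr : 0 < r) :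
    (0, r) ∈ radialDomain n := by
  refine ⟨hr, ?_⟩
  have h1 := coneCoeff_pos hn hr
  have h2 := coneConst_pos hn
  simp only [mem_preimage, mem_compl_iff, mem_singleton_iff, scaledP_zero hn]
  positivity

theorem sqrt_mem_radialDomain {n : ℕ} (hn : 2 ≤ n) {c r : ℝ} (hc : 0 < c) (hr : 0 < r) :
    (√c, r) ∈ radialDomain n :=
  ⟨hr, (scaledP_pos hn hc (coneCoeff_pos hn hr)).ne'⟩

theorem contDiffOn_radialCoeff_sqrt {n : ℕ} (hn : 2 ≤ n) {c : ℝ} (hc : 0 < c) :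
    ContDiffOn ℝ ∞ (radialCoeff n √c) (Ioi 0) :=
  (contDiffOn_radialCoeff hn).comp (g := fun z : ℝ × ℝ => radialCoeff n z.1 z.2)
    (f := fun r : ℝ => (√c, r)) (contDiff_const.prodMk contDiff_id).contDiffOn
    fun _ hr => sqrt_mem_radialDomain hn hc hr

/-- The variable `s` as a function of the new radial coordinate, chosen so that
`c (s² - 1) = (2n / (2n - 3)) sinh² r`. -/
def sVar (n : ℕ) (c r : ℝ) : ℝ := √(1 + coneCoeff n r / c)

theorem sVar_sq {n : ℕ} (hn : 2 ≤ n) {c : ℝ} (hc : 0 < c) (r : ℝ) :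
    sVar n c r ^ 2 = 1 + coneCoeff n r / c := by
  have := coneCoeff_nonneg hn r
  rw [sVar, Real.sq_sqrt (by positivity)]

theorem gammaSq_sVar {n : ℕ} (hn : 2 ≤ n) {c : ℝ} (hc : 0 < c) (r : ℝ) :
    gammaSq c (sVar n c r) = coneCoeff n r := by
  rw [gammaSq, sVar_sq hn hc]; field_simp; ring

theorem one_le_sVar {n : ℕ} (hn : 2 ≤ n) {c : ℝ} (hc : 0 < c) (r : ℝ) : 1 ≤ sVar n c r := by
  have : 0 ≤ coneCoeff n r / c := div_nonneg (coneCoeff_nonneg hn r) hc.le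
  rw [sVar, Real.one_le_sqrt]; linarith

theorem one_lt_sVar {n : ℕ} (hn : 2 ≤ n) {c r : ℝ} (hc : 0 < c) (hr : 0 < r) :
    1 < sVar n c r := by
  have : 0 < coneCoeff n r / c := div_pos (coneCoeff_pos hn hr) hc
  exact Real.lt_sqrt_of_sq_lt (by linarith)

theorem contDiff_sVar {n : ℕ} (hn : 2 ≤ n) {c : ℝ} (hc : 0 < c) : ContDiff ℝ ∞ (sVar n c) := by
  refine (contDiff_const.add ((contDiff_coneCoeff n).div_const c)).sqrt fun r => ?_
  have := coneCoeff_nonneg hn r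
  positivity

theorem hasDerivAt_sVar {n : ℕ} (hn : 2 ≤ n) {c : ℝ} (hc : 0 < c) (r : ℝ) :
    HasDerivAt (sVar n c) (coneConst n * Real.sinh r * Real.cosh r / (c * sVar n c r)) r := by
  have h0 := coneCoeff_nonneg hn r
  have h1 : HasDerivAt (fun r => 1 + coneCoeff n r / c)
      (coneConst n * (2 * Real.sinh r ^ 1 * Real.cosh r) / c) r := by
    have := ((Real.hasDerivAt_sinh r).pow 2).const_mul (coneConst n)
    exact (this.div_const c).const_add 1
  have h2 : HasDerivAt (sVar n c) _ r := h1.sqrt (by positivity)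
  have h3 : 0 < sVar n c r := by linarith [one_le_sVar hn hc r]
  convert h2 using 1
  change _ = _ / (2 * sVar n c r)
  field_simp

/-- This is $\alpha^2ds^2$ written in $dr^2$. The result involves $s$ only through $s^2=1+X/c$ and
$c^nP$, both of which rescale. -/
theorem alphaSq_sVar {n : ℕ} (hn : 2 ≤ n) {c r : ℝ} (hc : 0 < c) (hr : 0 < r) :
    alphaSq n c (sVar n c r) * (deriv (sVar n c) r) ^ 2 = radialCoeff n √c r := by
  have h0 := coneCoeff_pos hn hr
  have h1 := polyP_pos hn hc (one_lt_sVar hn hc hr)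
  have h3 : 0 < sVar n c r := by linarith [one_le_sVar hn hc r]
  have h5 : (coneConst n * Real.sinh r * Real.cosh r / (c * sVar n c r)) ^ 2 =
      coneConst n * Real.cosh r ^ 2 * coneCoeff n r / (c * (c + coneCoeff n r)) := by
    rw [div_pow, mul_pow c, sVar_sq hn hc, coneCoeff]
    have : 0 < c + coneConst n * Real.sinh r ^ 2 := add_pos hc h0
    have h6 : (1 + coneConst n * Real.sinh r ^ 2 / c) ≠ 0 := by
      have : 0 < coneConst n * Real.sinh r ^ 2 := h0
      positivity
    field_simp
  have h7 : scaledP n √c (coneCoeff n r) = c ^ n * polyP n c (sVar n c r) :=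
    scaledP_eq hn hc h0.le
  rw [(hasDerivAt_sVar hn hc r).deriv, h5, alphaSq, sVar_sq hn hc, radialCoeff, h7,
    Real.sq_sqrt hc.le, add_sub_cancel_left]
  obtain ⟨k, rfl⟩ : ∃ k, n = k + 1 := ⟨n - 1, by omega⟩
  rw [Nat.add_sub_cancel, div_pow]
  field_simp
  ring

/-- The coefficient of `θ²`. -/
def fiberCoeff (n : ℕ) (c r : ℝ) : ℝ := betaSq n c (sVar n c r)

theorem fiberCoeff_pos {n : ℕ} (hn : 2 ≤ n) {c r : ℝ} (hc : 0 < c) (hr : 0 < r) :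
    0 < fiberCoeff n c r := by
  have h := one_lt_sVar hn hc hr
  have h1 := polyP_pos hn hc h
  have h2 : 0 < sVar n c r ^ 2 - 1 := by nlinarith
  rw [fiberCoeff, betaSq]
  positivity

theorem contDiffOn_fiberCoeff {n : ℕ} (hn : 2 ≤ n) {c : ℝ} (hc : 0 < c) :
    ContDiffOn ℝ ∞ (fiberCoeff n c) (Ioi 0) := by
  have h1 : ContDiffOn ℝ ∞ (fun r => scaledP n √c (coneCoeff n r)) (Ioi 0) :=
    (contDiffOn_scaledP_coneCoeff hn).comp
      (g := fun z : ℝ × ℝ => scaledP n z.1 (coneCoeff n z.2)) (f := fun r : ℝ => (√c, r))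
      (contDiff_const.prodMk contDiff_id).contDiffOn fun _ hr => hr
  -- Substituting $s^2-1=X/c$ and $c^nP=$ `scaledP` into $\beta^2$ gives this expression.
  have h2 : ContDiffOn ℝ ∞ (fun r => c * scaledP n √c (coneCoeff n r) / coneCoeff n r ^ (n - 1))
      (Ioi 0) :=
    (contDiffOn_const.mul h1).div ((contDiff_coneCoeff n).pow _).contDiffOn fun r hr =>
      pow_ne_zero _ (coneCoeff_pos hn hr).ne'
  refine h2.congr fun r hr => ?_
  have h0 := coneCoeff_pos hn hr
  have h7 : scaledP n √c (coneCoeff n r) = c ^ n * polyP n c (sVar n c r) :=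
    scaledP_eq hn hc h0.le
  rw [fiberCoeff, betaSq, sVar_sq hn hc, add_sub_cancel_left, h7]
  obtain ⟨k, rfl⟩ : ∃ k, n = k + 1 := ⟨n - 1, by omega⟩
  rw [Nat.add_sub_cancel, div_pow]
  field_simp
  ring

/-- The factor $(s^2-1)^{n-1}$ in the bound for $P$ cancels the denominator of $\beta^2$, so the
estimate stays bounded down to $r=0$. The remaining $c^2\cdot c^{-1}\cdot(s-1)$ is of order $\sqrt
c$. -/
theorem fiberCoeff_le {n : ℕ} (hn : 2 ≤ n) {c r : ℝ} (hc : 0 < c) (hr : 0 < r) :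
    fiberCoeff n c r ≤
      √c * (((2 * (n : ℝ) - 1) * coneCoeff n r + 2 * (n : ℝ)) * √(coneCoeff n r)) := by
  have h := one_lt_sVar hn hc hr
  have h0 := coneCoeff_pos hn hr
  have h2 : 0 < sVar n c r ^ 2 - 1 := by nlinarith
  have hn2 : (2 : ℝ) ≤ n := by exact_mod_cast hn
  have h3 : 0 < 2 * (n : ℝ) - 1 := by linarith
  have h4 : sVar n c r - 1 ≤ √(coneCoeff n r) / √c := by
    rw [← Real.sqrt_div h0.le, sub_le_iff_le_add, sVar]
    -- The inequality is $\sqrt{1+y}\le 1+\sqrt y$ with $y=X/c$.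
    have h5 := Real.sqrt_nonneg (coneCoeff n r / c)
    rw [Real.sqrt_le_left (by positivity)]
    have h6 := Real.sq_sqrt (show 0 ≤ coneCoeff n r / c by positivity)
    nlinarith
  have h8 := Real.sqrt_pos.2 hc
  calc fiberCoeff n c r ≤ c ^ 2 * ((sVar n c r ^ 2 - 1) ^ (n - 1) *
        (((2 * (n : ℝ) - 1) * (sVar n c r ^ 2 - 1) + 2 * (n : ℝ) * c⁻¹) * (sVar n c r - 1))) /
        (sVar n c r ^ 2 - 1) ^ (n - 1) := by
        rw [fiberCoeff, betaSq]
        gcongr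
        exact polyP_le hn hc h.le
    _ = c ^ 2 * (((2 * (n : ℝ) - 1) * (coneCoeff n r / c) + 2 * (n : ℝ) * c⁻¹) *
          (sVar n c r - 1)) := by
        rw [sVar_sq hn hc, add_sub_cancel_left]
        field_simp
    _ ≤ c ^ 2 * (((2 * (n : ℝ) - 1) * (coneCoeff n r / c) + 2 * (n : ℝ) * c⁻¹) *
          (√(coneCoeff n r) / √c)) := by gcongr
    _ = c / √c * (((2 * (n : ℝ) - 1) * coneCoeff n r + 2 * (n : ℝ)) * √(coneCoeff n r)) := by
        field_simp
    _ = _ := by rw [Real.div_sqrt]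

end Coefficients

/-! ### The change of radius and its inverse. -/

section RadialFunction

/-- Solving this relation for $\rho^2$ yields the formula in `ballRadius`. -/
theorem radialVar_sub_one {c ρ : ℝ} : c ≠ 0 → c * (radialVar c ρ - 1) = 2 * ρ ^ 2 / (1 - ρ ^ 2) := by
  intro hc
  rw [radialVar]; field_simp; ring

/-- The Euclidean norm of a point of the ball as a function of the new radial coordinate. -/
def ballRadius (n : ℕ) (c r : ℝ) : ℝ := √(c * (sVar n c r - 1) / (2 + c * (sVar n c r - 1)))

/-- The new radial coordinate as a function of the Euclidean norm of a point of the ball. -/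
def newRadius (n : ℕ) (c ρ : ℝ) : ℝ :=
  Real.arsinh √(c * (radialVar c ρ ^ 2 - 1) / coneConst n)

variable {n : ℕ} {c : ℝ}

theorem ballRadius_sq (hn : 2 ≤ n) (hc : 0 < c) (r : ℝ) :
    ballRadius n c r ^ 2 = c * (sVar n c r - 1) / (2 + c * (sVar n c r - 1)) := by
  have := sub_nonneg.2 (one_le_sVar hn hc r)
  rw [ballRadius, Real.sq_sqrt (by positivity)]

theorem ballRadius_zero : ballRadius n c 0 = 0 := by
  simp [ballRadius, sVar, coneCoeff]

theorem newRadius_zero : newRadius n c 0 = 0 := by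
  simp [newRadius, radialVar]

theorem ballRadius_pos (hn : 2 ≤ n) (hc : 0 < c) {r : ℝ} (hr : 0 < r) : 0 < ballRadius n c r := by
  have := sub_pos.2 (one_lt_sVar hn hc hr)
  exact Real.sqrt_pos.2 (by positivity)

theorem ballRadius_lt_one (hn : 2 ≤ n) (hc : 0 < c) (r : ℝ) : ballRadius n c r < 1 := by
  have := sub_nonneg.2 (one_le_sVar hn hc r)
  have h : 0 ≤ c * (sVar n c r - 1) := by positivity
  rw [ballRadius, Real.sqrt_lt' one_pos, div_lt_iff₀ (by positivity)]
  linarith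

theorem radialVar_ballRadius (hn : 2 ≤ n) (hc : 0 < c) (r : ℝ) :
    radialVar c (ballRadius n c r) = sVar n c r := by
  have := sub_nonneg.2 (one_le_sVar hn hc r)
  have h : 0 ≤ c * (sVar n c r - 1) := by positivity
  have h2 : 0 < 2 + c * (sVar n c r - 1) := by positivity
  have h3 : 1 - c * (sVar n c r - 1) / (2 + c * (sVar n c r - 1)) =
      2 / (2 + c * (sVar n c r - 1)) := by field_simp; ring
  rw [radialVar, ballRadius_sq hn hc, h3]
  field_simp
  ring

theorem newRadius_ballRadius (hn : 2 ≤ n) (hc : 0 < c) {r : ℝ} (hr : 0 ≤ r) :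
    newRadius n c (ballRadius n c r) = r := by
  have h1 := coneConst_pos hn
  rw [newRadius, radialVar_ballRadius hn hc, sVar_sq hn hc, coneCoeff,
    show c * (1 + coneConst n * Real.sinh r ^ 2 / c - 1) / coneConst n = Real.sinh r ^ 2 by
      field_simp; ring, Real.sqrt_sq (Real.sinh_nonneg_iff.2 hr), Real.arsinh_sinh]

theorem one_le_radialVar (hc : 0 < c) {ρ : ℝ} (h0 : 0 ≤ ρ) (h1 : ρ < 1) : 1 ≤ radialVar c ρ := by
  have : 0 < 1 - ρ ^ 2 := by nlinarith
  rw [radialVar]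
  have : 0 ≤ 2 * c⁻¹ * ρ ^ 2 / (1 - ρ ^ 2) := by positivity
  linarith

theorem one_lt_radialVar (hc : 0 < c) {ρ : ℝ} (h0 : 0 < ρ) (h1 : ρ < 1) : 1 < radialVar c ρ := by
  have : 0 < 1 - ρ ^ 2 := by nlinarith
  rw [radialVar]
  have : 0 < 2 * c⁻¹ * ρ ^ 2 / (1 - ρ ^ 2) := by positivity
  linarith

theorem ballRadius_newRadius (hn : 2 ≤ n) (hc : 0 < c) {ρ : ℝ} (h0 : 0 ≤ ρ) (h1 : ρ < 1) :
    ballRadius n c (newRadius n c ρ) = ρ := by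
  have hk := coneConst_pos hn
  have h2 := one_le_radialVar hc h0 h1
  have h3 : 0 ≤ radialVar c ρ ^ 2 - 1 := by nlinarith
  have h4 : 0 < 1 - ρ ^ 2 := by nlinarith
  have h5 : sVar n c (newRadius n c ρ) = radialVar c ρ := by
    rw [sVar, coneCoeff, newRadius, Real.sinh_arsinh, Real.sq_sqrt (by positivity),
      show 1 + coneConst n * (c * (radialVar c ρ ^ 2 - 1) / coneConst n) / c = radialVar c ρ ^ 2 by
        field_simp; ring, Real.sqrt_sq (by linarith)]
  rw [ballRadius, h5, radialVar_sub_one hc.ne',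
    show 2 * ρ ^ 2 / (1 - ρ ^ 2) / (2 + 2 * ρ ^ 2 / (1 - ρ ^ 2)) = ρ ^ 2 by
      have : 2 + 2 * ρ ^ 2 / (1 - ρ ^ 2) = 2 / (1 - ρ ^ 2) := by field_simp; ring
      rw [this]; field_simp, Real.sqrt_sq h0]

theorem newRadius_pos (hn : 2 ≤ n) (hc : 0 < c) {ρ : ℝ} (h0 : 0 < ρ) (h1 : ρ < 1) :
    0 < newRadius n c ρ := by
  have hk := coneConst_pos hn
  have h2 := one_lt_radialVar hc h0 h1
  have h3 : 0 < radialVar c ρ ^ 2 - 1 := by nlinarith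
  rw [newRadius, Real.arsinh_pos_iff]
  positivity

/-- The radicand vanishes at $r=0$, so smoothness is asserted only for $r>0$; at the origin
continuity is enough for the homeomorphism. -/
theorem contDiffOn_ballRadius (hn : 2 ≤ n) (hc : 0 < c) :
    ContDiffOn ℝ ∞ (ballRadius n c) (Ioi 0) := by
  have h1 : ContDiff ℝ ∞ (fun r => c * (sVar n c r - 1)) :=
    contDiff_const.mul ((contDiff_sVar hn hc).sub contDiff_const)
  have h2 : ∀ r, 0 ≤ c * (sVar n c r - 1) := fun r =>
    mul_nonneg hc.le (sub_nonneg.2 (one_le_sVar hn hc r))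
  refine ContDiffOn.sqrt (ContDiff.contDiffOn
    (h1.div (contDiff_const.add h1) fun r => ?_)) fun r hr => ?_
  · have := h2 r; positivity
  · have : 0 < c * (sVar n c r - 1) := mul_pos hc (sub_pos.2 (one_lt_sVar hn hc hr))
    positivity

theorem continuous_ballRadius (hn : 2 ≤ n) (hc : 0 < c) : Continuous (ballRadius n c) := by
  have h1 : Continuous (fun r => c * (sVar n c r - 1)) :=
    continuous_const.mul ((contDiff_sVar hn hc).continuous.sub continuous_const)
  have h2 : ∀ r, 0 ≤ c * (sVar n c r - 1) := fun r =>
    mul_nonneg hc.le (sub_nonneg.2 (one_le_sVar hn hc r))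
  refine Continuous.sqrt (h1.div (continuous_const.add h1) fun r => ?_)
  have := h2 r; positivity

theorem contDiffOn_radialVar (c : ℝ) : ContDiffOn ℝ ∞ (radialVar c) (Ico 0 1) := by
  refine contDiffOn_const.add (ContDiffOn.div (ContDiff.contDiffOn (by fun_prop))
    (ContDiff.contDiffOn (by fun_prop)) fun ρ hρ => ?_)
  have : 0 < 1 - ρ ^ 2 := by nlinarith [hρ.1, hρ.2]
  exact this.ne'

theorem contDiffOn_newRadius (hn : 2 ≤ n) (hc : 0 < c) :
    ContDiffOn ℝ ∞ (newRadius n c) (Ioo 0 1) := by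
  have hk := coneConst_pos hn
  refine Real.contDiff_arsinh.comp_contDiffOn (ContDiffOn.sqrt (ContDiffOn.div_const
    (contDiffOn_const.mul ((((contDiffOn_radialVar c).mono Ioo_subset_Ico_self).pow 2).sub
      contDiffOn_const)) _) fun ρ hρ => ?_)
  have h2 := one_lt_radialVar hc hρ.1 hρ.2
  have h3 : 0 < radialVar c ρ ^ 2 - 1 := by nlinarith
  positivity

theorem continuousOn_newRadius (n : ℕ) (c : ℝ) : ContinuousOn (newRadius n c) (Ico 0 1) :=
  Real.continuous_arsinh.comp_continuousOn (ContinuousOn.sqrt (ContinuousOn.div_const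
    (continuousOn_const.mul (((contDiffOn_radialVar c).continuousOn.pow 2).sub
      continuousOn_const)) _))

theorem deriv_radialVar_mul_deriv_ballRadius (hn : 2 ≤ n) (hc : 0 < c) {r : ℝ} (hr : 0 < r) :
    deriv (radialVar c) (ballRadius n c r) * deriv (ballRadius n c) r = deriv (sVar n c) r := by
  have h1 : DifferentiableAt ℝ (ballRadius n c) r :=
    ((contDiffOn_ballRadius hn hc).contDiffAt (Ioi_mem_nhds hr)).differentiableAt (by simp)
  have h2 : DifferentiableAt ℝ (radialVar c) (ballRadius n c r) :=
    ((contDiffOn_radialVar c).contDiffAt (Ico_mem_nhds (ballRadius_pos hn hc hr)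
      (ballRadius_lt_one hn hc r))).differentiableAt (by simp)
  rw [← deriv_comp r h2 h1]
  congr 1
  exact funext fun r => radialVar_ballRadius hn hc r

end RadialFunction

/-! ### The pulled back metric on the punctured space and the properties of $\Phi_c$. -/

section SourceMetric

variable {n : ℕ}

theorem hasFDerivAt_norm_dRho {x : CSpace n} (hx : x ≠ 0) :
    HasFDerivAt (fun y : CSpace n => ‖y‖) (dRho x) x := by
  have hn : 0 < ‖x‖ := norm_pos_iff.2 hx
  have h1 := (hasStrictFDerivAt_norm_sq (F := CSpace n) x).hasFDerivAt.sqrt (by positivity)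
  simp only [Real.sqrt_sq (norm_nonneg _)] at h1
  refine h1.congr_fderiv (ContinuousLinearMap.ext fun u => ?_)
  have h2 : innerSL ℝ x u = (inner ℂ x u).re := euclForm_apply x u
  rw [smul_apply, smul_apply, h2]
  change _ = ‖x‖⁻¹ * (inner ℂ x u).re
  simp only [smul_eq_mul, nsmul_eq_mul]
  push_cast
  field_simp

theorem dRho_apply (x u : CSpace n) : dRho x u = ‖x‖⁻¹ * (inner ℂ x u).re := rfl

theorem thetaForm_apply (x u : CSpace n) : thetaForm x u = (‖x‖ ^ 2)⁻¹ * (inner ℂ x u).im := rfl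

theorem dRho_I_smul (x : CSpace n) : dRho x (Complex.I • x) = 0 := by
  rw [dRho_apply, inner_smul_right, inner_self_re_im]
  simp [-Complex.ofReal_pow]

theorem thetaForm_I_smul {x : CSpace n} (hx : x ≠ 0) : thetaForm x (Complex.I • x) = 1 := by
  have : ‖x‖ ≠ 0 := norm_ne_zero_iff.2 hx
  rw [thetaForm_apply, inner_smul_right, inner_self_re_im]
  simp [-Complex.ofReal_pow, this]

/-- Only the shape matters: a real dilation plus a term with values in the real line of `x`, so `τ`
is left unspecified. -/
theorem hasFDerivAt_radialMap {f : ℝ → ℝ} {x : CSpace n} (hx : x ≠ 0)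
    (hf : DifferentiableAt ℝ f ‖x‖) : ∃ τ : CSpace n →L[ℝ] ℝ,
      HasFDerivAt (radialMap f) ((f ‖x‖ / ‖x‖) • ContinuousLinearMap.id ℝ (CSpace n) +
        τ.smulRight x) x := by
  have hn : ‖x‖ ≠ 0 := norm_ne_zero_iff.2 hx
  have h1 : DifferentiableAt ℝ (fun r => f r / r) ‖x‖ := hf.div differentiableAt_id hn
  have h2 : HasFDerivAt (fun y : CSpace n => f ‖y‖ / ‖y‖) _ x :=
    h1.hasFDerivAt.comp x (hasFDerivAt_norm_dRho hx)
  exact ⟨_, h2.smul (hasFDerivAt_id x)⟩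

theorem dRho_fderiv_radialMap {f : ℝ → ℝ} {x : CSpace n} (hx : x ≠ 0)
    (hf : DifferentiableAt ℝ f ‖x‖) (hpos : 0 < f ‖x‖) (u : CSpace n) :
    dRho (radialMap f x) (fderiv ℝ (radialMap f) x u) = deriv f ‖x‖ * dRho x u := by
  obtain ⟨τ, hτ⟩ := hasFDerivAt_radialMap hx hf
  have hne : radialMap f x ≠ 0 := by
    rw [← norm_pos_iff, norm_radialMap hx hpos.le]; exact hpos
  have h1 := (hasFDerivAt_norm_dRho hne).comp x hτ
  have h2 := hf.hasDerivAt.comp_hasFDerivAt x (hasFDerivAt_norm_dRho hx)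
  have hc : ContinuousAt (fun y : CSpace n => f ‖y‖) x :=
    hf.continuousAt.comp (f := fun y : CSpace n => ‖y‖) continuous_norm.continuousAt
  have h3 : (fun y : CSpace n => ‖y‖) ∘ radialMap f =ᶠ[𝓝 x] f ∘ fun y : CSpace n => ‖y‖ := by
    filter_upwards [isOpen_ne.mem_nhds hx, hc.eventually (lt_mem_nhds hpos)] with y hy hy2
    exact norm_radialMap hy (le_of_lt hy2)
  have h4 := congrArg (fun T : CSpace n →L[ℝ] ℝ => T u)
    ((h1.congr_of_eventuallyEq h3.symm).unique h2)
  rw [hτ.fderiv]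
  simpa using h4

theorem fderiv_radialMap_apply {f : ℝ → ℝ} {x : CSpace n} (hx : x ≠ 0)
    (hf : DifferentiableAt ℝ f ‖x‖) (hpos : 0 < f ‖x‖) (u : CSpace n) :
    ∃ a : ℝ, fderiv ℝ (radialMap f) x u = ((f ‖x‖ / ‖x‖ : ℝ) : ℂ) • (u + (a : ℂ) • x) := by
  obtain ⟨τ, hτ⟩ := hasFDerivAt_radialMap hx hf
  have hn : ‖x‖ ≠ 0 := norm_ne_zero_iff.2 hx
  refine ⟨(f ‖x‖ / ‖x‖)⁻¹ * τ u, ?_⟩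
  rw [hτ.fderiv, smul_add, Complex.coe_smul, Complex.coe_smul, Complex.coe_smul, smul_smul,
    mul_inv_cancel_left₀ (div_ne_zero hpos.ne' hn)]
  simp

/-- A real multiple of `x` does not change $\operatorname{Im}\langle x,\cdot\rangle$, and the
dilation factors cancel against the norm. -/
theorem thetaForm_fderiv_radialMap {f : ℝ → ℝ} {x : CSpace n} (hx : x ≠ 0)
    (hf : DifferentiableAt ℝ f ‖x‖) (hpos : 0 < f ‖x‖) (u : CSpace n) :
    thetaForm (radialMap f x) (fderiv ℝ (radialMap f) x u) = thetaForm x u := by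
  obtain ⟨a, ha⟩ := fderiv_radialMap_apply hx hf hpos u
  have hn : ‖x‖ ≠ 0 := norm_ne_zero_iff.2 hx
  rw [ha, thetaForm_apply, norm_radialMap hx hpos.le, radialMap, ← Complex.coe_smul,
    inner_smul_left, inner_smul_right, inner_add_right, inner_smul_right, inner_self_re_im,
    Complex.conj_ofReal, Complex.im_ofReal_mul, Complex.im_ofReal_mul, Complex.add_im,
    ← Complex.ofReal_mul, Complex.ofReal_im, thetaForm_apply]
  field_simp
  ring

theorem fubiniStudyLift_fderiv_radialMap {f : ℝ → ℝ} {x : CSpace n} (hx : x ≠ 0)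
    (hf : DifferentiableAt ℝ f ‖x‖) (hpos : 0 < f ‖x‖) (u v : CSpace n) :
    fubiniStudyLift (radialMap f x) (fderiv ℝ (radialMap f) x u) (fderiv ℝ (radialMap f) x v) =
      fubiniStudyLift x u v := by
  obtain ⟨a, ha⟩ := fderiv_radialMap_apply hx hf hpos u
  obtain ⟨b, hb⟩ := fderiv_radialMap_apply hx hf hpos v
  have hn : ‖x‖ ≠ 0 := norm_ne_zero_iff.2 hx
  rw [ha, hb, radialMap, ← Complex.coe_smul, fubiniStudyLift_smul, fubiniStudyLift_add_smul]
  exact Complex.ofReal_ne_zero.2 (div_ne_zero hpos.ne' hn)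

/-- The bilinear forms `a(ρ) dρ² + b(ρ) θ² + k(ρ) g_{CP^{n-1}}`. -/
def cohomOneForm (a b k : ℝ → ℝ) (x : CSpace n) : CSpace n →L[ℝ] CSpace n →L[ℝ] ℝ :=
  a ‖x‖ • sqForm (dRho x) + b ‖x‖ • sqForm (thetaForm x) + k ‖x‖ • fubiniStudyLift x

theorem cohomOneForm_apply (a b k : ℝ → ℝ) (x u v : CSpace n) : cohomOneForm a b k x u v =
    a ‖x‖ * (dRho x u * dRho x v) + b ‖x‖ * (thetaForm x u * thetaForm x v) +
      k ‖x‖ * fubiniStudyLift x u v := by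
  simp [cohomOneForm, sqForm_apply]

theorem cohomOneForm_symm (a b k : ℝ → ℝ) (x u v : CSpace n) :
    cohomOneForm a b k x u v = cohomOneForm a b k x v u := by
  rw [cohomOneForm_apply, cohomOneForm_apply, fubiniStudyLift_symm x u v]
  ring

/-- If $d\rho$ and $\theta$ both vanish on `u`, then $\langle x,u\rangle=0$ and the Fubini–Study
term is $|u|^2/|x|^2$. -/
theorem cohomOneForm_pos {a b k : ℝ → ℝ} {x u : CSpace n} (hx : x ≠ 0) (hu : u ≠ 0)
    (ha : 0 < a ‖x‖) (hb : 0 < b ‖x‖) (hk : 0 < k ‖x‖) : 0 < cohomOneForm a b k x u u := by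
  have hn : 0 < ‖x‖ := norm_pos_iff.2 hx
  have hun : 0 < ‖u‖ := norm_pos_iff.2 hu
  have h1 := fubiniStudyLift_nonneg x u
  have h2 := mul_self_nonneg (dRho x u)
  have h3 := mul_self_nonneg (thetaForm x u)
  rw [cohomOneForm_apply]
  by_cases hd : dRho x u = 0
  · by_cases ht : thetaForm x u = 0
    · have h4 : (inner ℂ x u).re = 0 := by simpa [dRho_apply, hn.ne'] using hd
      have h5 : (inner ℂ x u).im = 0 := by simpa [thetaForm_apply, hn.ne'] using ht
      have h6 : 0 < fubiniStudyLift x u u := by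
        rw [fubiniStudyLift_apply, h4, h5, inner_self_re_im, Complex.ofReal_re]
        simp only [mul_zero, add_zero, sub_zero]
        positivity
      rw [hd, ht]
      simpa using mul_pos hk h6
    · have : 0 < thetaForm x u * thetaForm x u := mul_self_pos.2 ht
      positivity
  · have : 0 < dRho x u * dRho x u := mul_self_pos.2 hd
    positivity

theorem contDiffOn_cohomOneForm {a b k : ℝ → ℝ} (ha : ContDiffOn ℝ ∞ a (Ioi 0))
    (hb : ContDiffOn ℝ ∞ b (Ioi 0)) (hk : ContDiffOn ℝ ∞ k (Ioi 0)) :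
    ContDiffOn ℝ ∞ (cohomOneForm (n := n) a b k) {0}ᶜ := by
  rw [contDiffOn_clm_apply]
  intro u
  rw [contDiffOn_clm_apply]
  intro v
  have hn0 : ∀ x ∈ ({0}ᶜ : Set (CSpace n)), ‖x‖ ≠ 0 := fun x hx => norm_ne_zero_iff.2 hx
  have hm : MapsTo (fun x : CSpace n => ‖x‖) {0}ᶜ (Ioi 0) := fun x hx => norm_pos_iff.2 hx
  have hn : ContDiffOn ℝ ∞ (fun x : CSpace n => ‖x‖) {0}ᶜ := contDiffOn_id.norm ℝ fun x hx => hx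
  have hi : ∀ u : CSpace n, ContDiff ℝ ∞ (fun w : CSpace n => inner ℂ w u) := fun u =>
    contDiff_id.inner ℂ contDiff_const
  have hre : ∀ u : CSpace n, ContDiffOn ℝ ∞ (fun w : CSpace n => (inner ℂ w u).re) {0}ᶜ :=
    fun u => (Complex.reCLM.contDiff.comp (hi u)).contDiffOn
  have him : ∀ u : CSpace n, ContDiffOn ℝ ∞ (fun w : CSpace n => (inner ℂ w u).im) {0}ᶜ :=
    fun u => (Complex.imCLM.contDiff.comp (hi u)).contDiffOn
  have hp : ∀ j : ℕ, ContDiffOn ℝ ∞ (fun x : CSpace n => (‖x‖ ^ j)⁻¹) {0}ᶜ := fun j =>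
    (hn.pow j).inv fun x hx => pow_ne_zero j (hn0 x hx)
  have hd : ∀ u : CSpace n, ContDiffOn ℝ ∞ (fun x : CSpace n => dRho x u) {0}ᶜ := fun u =>
    (hn.inv hn0).mul (hre u)
  have ht : ∀ u : CSpace n, ContDiffOn ℝ ∞ (fun x : CSpace n => thetaForm x u) {0}ᶜ := fun u =>
    (hp 2).mul (him u)
  simp only [cohomOneForm_apply, fubiniStudyLift_apply]
  exact (((ha.comp hn hm).mul ((hd u).mul (hd v))).add
    ((hb.comp hn hm).mul ((ht u).mul (ht v)))).add ((hk.comp hn hm).mul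
      (((hp 2).mul contDiffOn_const).sub ((hp 4).mul (((hre u).mul (hre v)).add
        ((him u).mul (him v))))))

/-- The diffeomorphism `Φ_c` from the punctured space to the punctured ball. -/
def ballMap (n : ℕ) (c : ℝ) : CSpace n → CSpace n := radialMap (ballRadius n c)

variable {c : ℝ}

/-- A radial map preserves $\theta$ and the lifted Fubini–Study form and multiplies $d\rho$ by
$\rho'(r)$; the chain rule turns $s'(\rho)\rho'(r)$ into $ds/dr$. -/
theorem formEval_pullback_ballMetric (hn : 2 ≤ n) (hc : 0 < c) {x : CSpace n} (hx : x ≠ 0)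
    (u v : CSpace n) :
    formEval 𝓘(ℝ, CSpace n) (pullbackForm 𝓘(ℝ, CSpace n) 𝓘(ℝ, CSpace n) (ballMap n c)
      (ballMetric n c)) x u v =
      cohomOneForm (radialCoeff n √c) (fiberCoeff n c) (coneCoeff n) x u v := by
  have hr : 0 < ‖x‖ := norm_pos_iff.2 hx
  have hpos := ballRadius_pos hn hc hr
  have hf : DifferentiableAt ℝ (ballRadius n c) ‖x‖ :=
    ((contDiffOn_ballRadius hn hc).contDiffAt (Ioi_mem_nhds hr)).differentiableAt (by simp)
  have h1 : ∀ y a b : CSpace n, formEval 𝓘(ℝ, CSpace n) (ballMetric n c) y a b =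
      alphaSq n c (radialVar c ‖y‖) * deriv (radialVar c) ‖y‖ ^ 2 * (dRho y a * dRho y b) +
        betaSq n c (radialVar c ‖y‖) * (thetaForm y a * thetaForm y b) +
        gammaSq c (radialVar c ‖y‖) * fubiniStudyLift y a b := by
    intro y a b
    rw [← sqForm_apply, ← sqForm_apply]
    rfl
  rw [formEval_pullbackForm, modelDeriv_vectorSpace, h1, cohomOneForm_apply, ballMap,
    dRho_fderiv_radialMap hx hf hpos, dRho_fderiv_radialMap hx hf hpos,
    thetaForm_fderiv_radialMap hx hf hpos, thetaForm_fderiv_radialMap hx hf hpos,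
    fubiniStudyLift_fderiv_radialMap hx hf hpos, norm_radialMap hx hpos.le,
    radialVar_ballRadius hn hc, gammaSq_sVar hn hc, ← alphaSq_sVar hn hc hr,
    ← deriv_radialVar_mul_deriv_ballRadius hn hc hr, fiberCoeff]
  ring

theorem isDiffeoOn_ballMap (hn : 2 ≤ n) (hc : 0 < c) :
    IsDiffeoOn (ballMap n c) {0}ᶜ (Metric.ball 0 1 \ {0}) := by
  have hinv : InvOn (radialMap (newRadius n c)) (ballMap n c) ({0}ᶜ : Set (CSpace n))
      (Metric.ball 0 1 \ {0}) := by
    refine ⟨fun x hx => ?_, fun x hx => ?_⟩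
    · have hr : 0 < ‖x‖ := norm_pos_iff.2 hx
      exact radialMap_radialMap (ballRadius_pos hn hc hr) (newRadius_ballRadius hn hc hr.le)
    · have hr : 0 < ‖x‖ := norm_pos_iff.2 hx.2
      have h1 : ‖x‖ < 1 := mem_ball_zero_iff.1 hx.1
      exact radialMap_radialMap (newRadius_pos hn hc hr h1) (ballRadius_newRadius hn hc hr.le h1)
  have hm1 : MapsTo (ballMap n c) ({0}ᶜ : Set (CSpace n)) (Metric.ball 0 1 \ {0}) := fun x hx => by
    have hp := ballRadius_pos hn hc (norm_pos_iff.2 hx)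
    have h := norm_radialMap (f := ballRadius n c) hx hp.le
    refine ⟨mem_ball_zero_iff.2 ?_, norm_pos_iff.1 ?_⟩
    · exact h.trans_lt (ballRadius_lt_one hn hc _)
    · exact hp.trans_eq h.symm
  have hm2 : MapsTo (radialMap (newRadius n c)) (Metric.ball 0 1 \ {0}) ({0}ᶜ : Set (CSpace n)) :=
    fun x hx => by
      have hp := newRadius_pos hn hc (norm_pos_iff.2 hx.2) (mem_ball_zero_iff.1 hx.1)
      have h := norm_radialMap (f := newRadius n c) hx.2 hp.le
      exact norm_pos_iff.1 (hp.trans_eq h.symm)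
  refine ⟨contDiffOn_radialMap (t := Ioi 0) (fun x hx => norm_pos_iff.2 hx) (fun x hx => hx)
    (contDiffOn_ballRadius hn hc), hinv.bijOn hm1 hm2, radialMap (newRadius n c),
    contDiffOn_radialMap (t := Ioo 0 1) (fun x hx => ⟨norm_pos_iff.2 hx.2,
      mem_ball_zero_iff.1 hx.1⟩) (fun x hx => hx.2) (contDiffOn_newRadius hn hc), hinv⟩

theorem exists_homeomorph_ballMap (hn : 2 ≤ n) (hc : 0 < c) :
    ∃ h : CSpace n ≃ₜ Metric.ball (0 : CSpace n) 1, ∀ x, (h x : CSpace n) = ballMap n c x := by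
  have hm : ∀ x : CSpace n, ballMap n c x ∈ Metric.ball (0 : CSpace n) 1 := fun x => by
    rcases eq_or_ne x 0 with rfl | hx
    · simp [ballMap]
    · exact ((isDiffeoOn_ballMap hn hc).2.1.mapsTo hx).1
  refine ⟨{ toFun := fun x => ⟨ballMap n c x, hm x⟩
            invFun := fun y => radialMap (newRadius n c) (y : CSpace n)
            left_inv := fun x => ?_
            right_inv := fun y => Subtype.ext ?_
            continuous_toFun := Continuous.subtype_mk ?_ _
            continuous_invFun := ?_ }, fun x => rfl⟩
  · rcases eq_or_ne x 0 with rfl | hx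
    · simp [ballMap]
    have hr : 0 < ‖x‖ := norm_pos_iff.2 hx
    exact radialMap_radialMap (ballRadius_pos hn hc hr) (newRadius_ballRadius hn hc hr.le)
  · obtain ⟨y, hy⟩ := y
    rcases eq_or_ne y 0 with rfl | hy0
    · simp [ballMap]
    have hr : 0 < ‖y‖ := norm_pos_iff.2 hy0
    have h1 : ‖y‖ < 1 := mem_ball_zero_iff.1 hy
    exact radialMap_radialMap (newRadius_pos hn hc hr h1) (ballRadius_newRadius hn hc hr.le h1)
  · rw [← continuousOn_univ]
    exact continuousOn_radialMap (t := univ) (mapsTo_univ _ _)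
      (continuous_ballRadius hn hc).continuousOn ballRadius_zero
  · have := continuousOn_radialMap (V := CSpace n) (s := Metric.ball 0 1) (t := Ico 0 1)
      (fun x hx => ⟨norm_nonneg x, mem_ball_zero_iff.1 hx⟩) (continuousOn_newRadius n c)
      newRadius_zero
    exact continuousOn_iff_continuous_domRestrict.1 this

theorem norm_matAct {A : Matrix (Fin n) (Fin n) ℂ}
    (hA : A ∈ Matrix.specialUnitaryGroup (Fin n) ℂ) (x : CSpace n) : ‖matAct A x‖ = ‖x‖ := by
  have hU := (Matrix.mem_specialUnitaryGroup_iff.1 hA).1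
  have h1 : inner ℂ (matAct A x) (matAct A x) = inner ℂ x x := by
    rw [EuclideanSpace.inner_eq_star_dotProduct, EuclideanSpace.inner_eq_star_dotProduct]
    simp only [matAct]
    rw [Matrix.star_mulVec, dotProduct_comm, ← Matrix.dotProduct_mulVec, Matrix.mulVec_mulVec]
    have : A.conjTranspose * A = 1 := Matrix.mem_unitaryGroup_iff'.1 hU
    rw [this, Matrix.one_mulVec, dotProduct_comm]
  rw [inner_self_re_im, inner_self_re_im, Complex.ofReal_inj] at h1
  exact (sq_eq_sq₀ (norm_nonneg _) (norm_nonneg _)).1 h1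

/-- A radial map commutes with every linear isometry. -/
theorem ballMap_matAct {A : Matrix (Fin n) (Fin n) ℂ}
    (hA : A ∈ Matrix.specialUnitaryGroup (Fin n) ℂ) (x : CSpace n) :
    ballMap n c (matAct A x) = matAct A (ballMap n c x) := by
  simp only [ballMap, radialMap, norm_matAct hA]
  simp [matAct, Matrix.mulVec_smul]

theorem formEval_coordForm_refl {E : Type*} [NormedAddCommGroup E] [NormedSpace ℝ E]
    (g : FormField 𝓘(ℝ, E) E) (y u v : E) :
    coordForm 𝓘(ℝ, E) (OpenPartialHomeomorph.refl E) g y u v = formEval 𝓘(ℝ, E) g y u v := by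
  have h : modelDeriv 𝓘(ℝ, E) 𝓘(ℝ, E) (id : E → E) y = ContinuousLinearMap.id ℝ E := mfderiv_id
  change formEval 𝓘(ℝ, E) (pullbackForm 𝓘(ℝ, E) 𝓘(ℝ, E) (id : E → E) g) y u v = _
  rw [formEval_pullbackForm, h]
  rfl

theorem isRiemannianMetricOn_pullback_ballMetric (hn : 2 ≤ n) (hc : 0 < c) :
    IsRiemannianMetricOn 𝓘(ℝ, CSpace n) {0}ᶜ (pullbackForm 𝓘(ℝ, CSpace n) 𝓘(ℝ, CSpace n)
      (ballMap n c) (ballMetric n c)) where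
  symm x hx u v := by
    exact ((formEval_pullback_ballMetric hn hc hx u v).trans
      (cohomOneForm_symm _ _ _ x u v)).trans
      (formEval_pullback_ballMetric hn hc hx v u).symm
  pos x hx u hu := by
    have hr : 0 < ‖x‖ := norm_pos_iff.2 hx
    exact (cohomOneForm_pos hx hu (radialCoeff_pos hn hc hr) (fiberCoeff_pos hn hc hr)
      (coneCoeff_pos hn hr)).trans_eq (formEval_pullback_ballMetric hn hc hx u u).symm
  smooth e he := by
    rw [chartedSpaceSelf_atlas] at he
    subst he
    have h := contDiffOn_cohomOneForm (n := n) (contDiffOn_radialCoeff_sqrt hn hc)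
      (contDiffOn_fiberCoeff hn hc) (contDiff_coneCoeff n).contDiffOn
    refine (h.congr fun y hy => ?_).mono fun y hy => hy.2
    ext u v
    rw [formEval_coordForm_refl, formEval_pullback_ballMetric hn hc hy]

end SourceMetric

/-! ### Warped metrics on $\mathbb{R}\times\mathbb{CP}^m$ and their convergence. -/

section ProductMetric

variable {m : ℕ}

section Prod

variable {E : Type*} [NormedAddCommGroup E] [NormedSpace ℝ E]
  {H : Type*} [TopologicalSpace H] {I : ModelWithCorners ℝ E H}
  {E' : Type*} [NormedAddCommGroup E'] [NormedSpace ℝ E']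
  {H' : Type*} [TopologicalSpace H'] {I' : ModelWithCorners ℝ E' H'}
  {E'' : Type*} [NormedAddCommGroup E''] [NormedSpace ℝ E'']
  {H'' : Type*} [TopologicalSpace H''] {I'' : ModelWithCorners ℝ E'' H''}
  {M : Type*} [TopologicalSpace M] [ChartedSpace H M]
  {N : Type*} [TopologicalSpace N] [ChartedSpace H' N]
  {N' : Type*} [TopologicalSpace N'] [ChartedSpace H'' N']

theorem modelDeriv_prodMk {f : M → N} {f' : M → N'} {x : M} (hf : MDifferentiableAt I I' f x)
    (hf' : MDifferentiableAt I I'' f' x) (u : E) :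
    modelDeriv I (I'.prod I'') (fun x => (f x, f' x)) x u =
      (modelDeriv I I' f x u, modelDeriv I I'' f' x u) :=
  congrArg (fun T : E →L[ℝ] E' × E'' => T u) (mfderiv_prodMk hf hf')

end Prod

/-- The metrics `a(r) dr² + k(r) g_{CP^m}` on `ℝ × CP^m`. -/
def warpedForm (m : ℕ) (a k : ℝ → ℝ) : FormField (XModel m) (ℝ × CP m) := fun b =>
  a b.1 • pullbackForm (XModel m) 𝓘(ℝ, ℝ) Prod.fst
      (fun _ => sqForm (ContinuousLinearMap.id ℝ ℝ)) b
    + k b.1 • pullbackForm (XModel m) 𝓘(ℝ, CSpace m) Prod.snd (CP.fubiniStudy m) b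

theorem formEval_warpedForm (a k : ℝ → ℝ) (b : ℝ × CP m) (u v : ℝ × CSpace m) :
    formEval (XModel m) (warpedForm m a k) b u v = a b.1 * (u.1 * v.1) +
      k b.1 * formEval 𝓘(ℝ, CSpace m) (CP.fubiniStudy m) b.2 u.2 v.2 := by
  have h1 : modelDeriv (XModel m) 𝓘(ℝ, ℝ) (Prod.fst : ℝ × CP m → ℝ) b =
    ContinuousLinearMap.fst ℝ ℝ (CSpace m) := mfderiv_fst
  have h2 : modelDeriv (XModel m) 𝓘(ℝ, CSpace m) (Prod.snd : ℝ × CP m → CP m) b =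
    ContinuousLinearMap.snd ℝ ℝ (CSpace m) := mfderiv_snd
  have h3 := formEval_pullbackForm (XModel m) 𝓘(ℝ, CSpace m) (Prod.snd : ℝ × CP m → CP m)
    (CP.fubiniStudy m) b u v
  have h4 := formEval_pullbackForm_vectorSpace (XModel m) (Prod.fst : ℝ × CP m → ℝ)
    (fun _ => sqForm (ContinuousLinearMap.id ℝ ℝ)) b u v
  rw [h2] at h3
  rw [h1, sqForm_apply] at h4
  have h5 : formEval (XModel m) (warpedForm m a k) b u v =
      a b.1 * formEval (XModel m) (pullbackForm (XModel m) 𝓘(ℝ, ℝ) Prod.fst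
        (fun _ => sqForm (ContinuousLinearMap.id ℝ ℝ))) b u v +
      k b.1 * formEval (XModel m) (pullbackForm (XModel m) 𝓘(ℝ, CSpace m) Prod.snd
        (CP.fubiniStudy m)) b u v := by
    have hlin : ∀ (s t : ℝ) (A B : (ℝ × CSpace m) →L[ℝ] (ℝ × CSpace m) →L[ℝ] ℝ),
        (s • A + t • B) u v = s * A u v + t * B u v := fun s t A B => by simp
    exact hlin _ _ _ _
  rw [h5, h3, h4]
  rfl

/-- The coefficients of `warpedForm` in the charts of `ℝ × CP^m`. -/
def warpedCoord (m : ℕ) (a k : ℝ → ℝ) (y : ℝ × CSpace m) :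
    (ℝ × CSpace m) →L[ℝ] (ℝ × CSpace m) →L[ℝ] ℝ :=
  a y.1 • sqForm (ContinuousLinearMap.fst ℝ ℝ (CSpace m)) +
    k y.1 • (CP.fubiniStudyCoord y.2).bilinearComp (ContinuousLinearMap.snd ℝ ℝ (CSpace m))
      (ContinuousLinearMap.snd ℝ ℝ (CSpace m))

theorem warpedCoord_apply (a k : ℝ → ℝ) (y u v : ℝ × CSpace m) : warpedCoord m a k y u v =
    a y.1 * (u.1 * v.1) + k y.1 * CP.fubiniStudyCoord y.2 u.2 v.2 := by
  simp [warpedCoord, sqForm_apply]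

theorem exists_eq_of_mem_atlas {e : OpenPartialHomeomorph (ℝ × CP m) (ModelProd ℝ (CSpace m))}
    (he : e ∈ atlas (ModelProd ℝ (CSpace m)) (ℝ × CP m)) :
    ∃ i, e = (OpenPartialHomeomorph.refl ℝ).prod (CP.affineChart i) := by
  obtain ⟨e₁, h₁, e₂, ⟨i, rfl⟩, rfl⟩ := he
  rw [chartedSpaceSelf_atlas] at h₁
  exact ⟨i, by rw [h₁]⟩

/-- Each chart is the identity times an affine chart, whose inverse is defined on all of
$\mathbb{C}^m$; hence the equality is global and the same in every chart. -/
theorem coordForm_warpedForm {e : OpenPartialHomeomorph (ℝ × CP m) (ModelProd ℝ (CSpace m))}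
    (he : e ∈ atlas (ModelProd ℝ (CSpace m)) (ℝ × CP m)) (a k : ℝ → ℝ) :
    coordForm (XModel m) e (warpedForm m a k) = warpedCoord m a k := by
  obtain ⟨i, rfl⟩ := exists_eq_of_mem_atlas he
  funext y
  refine ContinuousLinearMap.ext fun u => ContinuousLinearMap.ext fun v => ?_
  have h1 : MDifferentiableAt 𝓘(ℝ, ℝ × CSpace m) 𝓘(ℝ, ℝ) (Prod.fst : ℝ × CSpace m → ℝ) y :=
    differentiableAt_fst.mdifferentiableAt
  have h2 : MDifferentiableAt 𝓘(ℝ, ℝ × CSpace m) 𝓘(ℝ, CSpace m)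
      (Prod.snd : ℝ × CSpace m → CSpace m) y := differentiableAt_snd.mdifferentiableAt
  have h3 : MDifferentiableAt 𝓘(ℝ, CSpace m) 𝓘(ℝ, CSpace m) (CP.affineChart i).symm y.2 :=
    (contMDiff_affineChart_symm i).mdifferentiableAt (by simp)
  have h4 : MDifferentiableAt 𝓘(ℝ, ℝ × CSpace m) 𝓘(ℝ, CSpace m)
      ((CP.affineChart i).symm ∘ Prod.snd) y := h3.comp y h2
  have h5 : ∀ u : ℝ × CSpace m, modelDeriv 𝓘(ℝ, ℝ × CSpace m) (XModel m)
      (fun y : ℝ × CSpace m => (y.1, ((CP.affineChart i).symm ∘ Prod.snd) y)) y u =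
      (u.1, modelDeriv 𝓘(ℝ, CSpace m) 𝓘(ℝ, CSpace m) (CP.affineChart i).symm y.2 u.2) := by
    intro u
    rw [modelDeriv_prodMk h1 h4, modelDeriv_vectorSpace, fderiv_fst,
      modelDeriv_comp _ 𝓘(ℝ, CSpace m) _ h3 h2, modelDeriv_vectorSpace, fderiv_snd]
    rfl
  have h6 := formEval_pullbackForm 𝓘(ℝ, ℝ × CSpace m) (XModel m)
    (fun y : ℝ × CSpace m => (y.1, ((CP.affineChart i).symm ∘ Prod.snd) y)) (warpedForm m a k) y u v
  rw [h5, h5, formEval_warpedForm] at h6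
  have h7 := fubiniStudy_affineChart_symm i y.2 u.2 v.2
  rw [formEval_pullbackForm] at h7
  rw [warpedCoord_apply, ← h7]
  exact h6

theorem limitMetric_eq (m : ℕ) :
    limitMetric m = warpedForm m (fun _ => 1) (coneCoeff (m + 1)) := by
  funext b
  unfold limitMetric warpedForm coneCoeff coneConst
  rw [one_smul]
  push_cast
  with_reducible rfl

theorem contDiffOn_warpedCoord {G : Type*} [NormedAddCommGroup G] [NormedSpace ℝ G]
    {a : G → ℝ → ℝ} {k : ℝ → ℝ} {U : Set (G × ℝ)}
    (ha : ContDiffOn ℝ ∞ (fun z : G × ℝ => a z.1 z.2) U) (hk : ContDiff ℝ ∞ k) :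
    ContDiffOn ℝ ∞ (Function.uncurry fun ε => warpedCoord m (a ε) k)
      {z : G × (ℝ × CSpace m) | (z.1, z.2.1) ∈ U} := by
  rw [contDiffOn_clm_apply]
  intro u
  rw [contDiffOn_clm_apply]
  intro v
  have h1 : ContDiff ℝ ∞ (fun z : G × (ℝ × CSpace m) => (z.1, z.2.1)) :=
    contDiff_fst.prodMk (contDiff_fst.comp contDiff_snd)
  have h2 : ContDiffOn ℝ ∞ (fun z : G × (ℝ × CSpace m) => a z.1 z.2.1)
      {z : G × (ℝ × CSpace m) | (z.1, z.2.1) ∈ U} := ha.comp h1.contDiffOn fun z hz => hz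
  have h3 : ContDiff ℝ ∞ (fun z : G × (ℝ × CSpace m) => k z.2.1) :=
    hk.comp (contDiff_fst.comp contDiff_snd)
  have h4 : ContDiff ℝ ∞ (fun z : G × (ℝ × CSpace m) => CP.fubiniStudyCoord z.2.2 u.2 v.2) :=
    (((CP.contDiff_fubiniStudyCoord).clm_apply contDiff_const).clm_apply contDiff_const).comp
      (contDiff_snd.comp contDiff_snd)
  simp only [Function.uncurry, warpedCoord_apply]
  exact (h2.mul contDiffOn_const).add (h3.mul h4).contDiffOn

theorem isRiemannianMetricOn_warpedForm {a k : ℝ → ℝ} (ha : ContDiffOn ℝ ∞ a (Ioi 0))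
    (hk : ContDiff ℝ ∞ k) (ha0 : ∀ r, 0 < r → 0 < a r) (hk0 : ∀ r, 0 < r → 0 < k r) :
    IsRiemannianMetricOn (XModel m) (XStar m) (warpedForm m a k) where
  symm b hb u v := by
    have h : ∀ u v : ℝ × CSpace m, formEval (XModel m) (warpedForm m a k) b u v =
        formEval (XModel m) (warpedForm m a k) b v u := fun u v => by
      rw [formEval_warpedForm, formEval_warpedForm, fubiniStudy_symm, mul_comm u.1]
    exact h u v
  pos b hb u hu := by
    have h : ∀ u : ℝ × CSpace m, u ≠ 0 → 0 < formEval (XModel m) (warpedForm m a k) b u u := by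
      intro u hu
      rw [formEval_warpedForm]
      have h1 := ha0 b.1 hb
      have h2 := hk0 b.1 hb
      by_cases h3 : u.2 = 0
      · have h4 : u.1 ≠ 0 := fun h4 => hu (Prod.ext h4 h3)
        have h5 : 0 < u.1 * u.1 := mul_self_pos.2 h4
        have h6 : formEval 𝓘(ℝ, CSpace m) (CP.fubiniStudy m) b.2 u.2 u.2 = 0 := by
          rw [h3, formEval_fubiniStudy, map_zero, map_zero]
        rw [h6]
        positivity
      · have h5 := fubiniStudy_pos b.2 h3
        have := mul_self_nonneg u.1
        positivity
    exact h u hu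
  smooth e he := by
    rw [coordForm_warpedForm he]
    obtain ⟨i, rfl⟩ := exists_eq_of_mem_atlas he
    have h1 : ContDiffOn ℝ ∞ (fun z : ℝ × ℝ => a z.2) {z | 0 < z.2} :=
      ha.comp contDiff_snd.contDiffOn fun z hz => hz
    have h2 := contDiffOn_warpedCoord (m := m) (a := fun _ : ℝ => a) h1 hk
    exact h2.comp (f := fun y : ℝ × CSpace m => ((0 : ℝ), y))
      (contDiff_const.prodMk contDiff_id).contDiffOn fun y hy => hy.2

theorem smoothlyConvergesOn_warpedForm {n : ℕ} (hn : 2 ≤ n) {R₁ R₂ : ℝ} (hR : 0 < R₁) :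
    SmoothlyConvergesOn (XModel m) (XAnnulus m R₁ R₂)
      (fun c => warpedForm m (radialCoeff n √c) (coneCoeff n)) (𝓝[>] 0)
      (warpedForm m (fun _ => 1) (coneCoeff n)) := by
  intro e he K hK hKe k
  simp only [coordForm_warpedForm he]
  obtain ⟨i, rfl⟩ := exists_eq_of_mem_atlas he
  set e := (OpenPartialHomeomorph.refl ℝ).prod (CP.affineChart (m := m) i) with he'
  -- Compactness comes from `K`; the closed condition `R₁ ≤ y.1` keeps `K'` away from $r=0$, where
  -- `radialCoeff` need not be smooth.
  set K' : Set (ℝ × CSpace m) := (e.extend (XModel m) '' K) ∩ {y | R₁ ≤ y.1} with hK'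
  have hcK : IsCompact K' := by
    refine IsCompact.inter_right (hK.image_of_continuousOn ?_)
      (isClosed_le continuous_const continuous_fst)
    refine (OpenPartialHomeomorph.continuousOn_extend e).mono ?_
    rwa [OpenPartialHomeomorph.extend_source]
  have hsub : e.extend (XModel m) '' (XAnnulus m R₁ R₂ ∩ K) ⊆ K' := by
    rintro _ ⟨b, ⟨hb, hbK⟩, rfl⟩
    exact ⟨⟨b, hbK, rfl⟩, hb.1.le⟩
  have hε : Tendsto (fun c : ℝ => √c) (𝓝[>] 0) (𝓝 0) := by
    have := Real.continuous_sqrt.tendsto 0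
    rw [Real.sqrt_zero] at this
    exact this.mono_left nhdsWithin_le_nhds
  have hU : IsOpen {z : ℝ × (ℝ × CSpace m) | (z.1, z.2.1) ∈ radialDomain n} :=
    (isOpen_radialDomain hn).preimage (by fun_prop)
  have hconv := tendstoUniformlyOn_iteratedFDeriv_of_uncurry hε hU
    (contDiffOn_warpedCoord (m := m) (contDiffOn_radialCoeff hn) (contDiff_coneCoeff n)) hcK
    (fun y hy => zero_mem_radialDomain hn (hR.trans_le hy.2)) k
  refine (hconv.congr_right fun y hy => ?_).mono hsub
  -- The coefficient at $\varepsilon=0$ is identified with 1 only for $r>0$, so derivatives are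
  -- compared through germs.
  have hy0 : 0 < y.1 := hR.trans_le hy.2
  refine (Filter.EventuallyEq.iteratedFDeriv ℝ ?_ k).eq_of_nhds
  filter_upwards [(isOpen_lt continuous_const continuous_fst).mem_nhds hy0] with z hz
  unfold warpedCoord
  rw [radialCoeff_zero hn hz]

end ProductMetric

/-! ### The Riemannian submersion onto $X^*$. -/

section Submersion

variable {m : ℕ}

theorem mdifferentiableAt_norm {x : CSpace (m + 1)} (hx : x ≠ 0) :
    MDifferentiableAt 𝓘(ℝ, CSpace (m + 1)) 𝓘(ℝ, ℝ) (fun y : CSpace (m + 1) => ‖y‖) x :=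
  (hasFDerivAt_norm_dRho hx).differentiableAt.mdifferentiableAt

theorem modelDeriv_hopfProj {x : CSpace (m + 1)} (hx : x ≠ 0) (u : CSpace (m + 1)) :
    modelDeriv 𝓘(ℝ, CSpace (m + 1)) (XModel m) hopfProj x u =
      (dRho x u, modelDeriv 𝓘(ℝ, CSpace (m + 1)) 𝓘(ℝ, CSpace m) hopfLine x u) := by
  have h := modelDeriv_prodMk (mdifferentiableAt_norm hx) (mdifferentiableAt_hopfLine hx) u
  rw [modelDeriv_vectorSpace, (hasFDerivAt_norm_dRho hx).fderiv] at h
  exact h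

theorem formEval_warpedForm_hopfProj (a k : ℝ → ℝ) {x : CSpace (m + 1)} (hx : x ≠ 0)
    (u v : CSpace (m + 1)) :
    formEval (XModel m) (warpedForm m a k) (hopfProj x)
      (modelDeriv 𝓘(ℝ, CSpace (m + 1)) (XModel m) hopfProj x u)
      (modelDeriv 𝓘(ℝ, CSpace (m + 1)) (XModel m) hopfProj x v) =
      a ‖x‖ * (dRho x u * dRho x v) + k ‖x‖ * fubiniStudyLift x u v := by
  rw [formEval_warpedForm, modelDeriv_hopfProj hx, modelDeriv_hopfProj hx, hopfProj_eq,
    fubiniStudy_hopfLine hx]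

theorem contMDiffOn_hopfProj :
    ContMDiffOn 𝓘(ℝ, CSpace (m + 1)) (XModel m) ∞ (hopfProj (m := m)) {0}ᶜ := fun x hx => by
  have h1 : ContMDiffAt 𝓘(ℝ, CSpace (m + 1)) 𝓘(ℝ, ℝ) ∞ (fun y : CSpace (m + 1) => ‖y‖) x :=
    (contDiffAt_norm ℝ hx).contMDiffAt
  exact (h1.prodMk (contMDiffAt_hopfLine hx)).contMDiffWithinAt

theorem image_hopfProj : hopfProj '' ({0}ᶜ : Set (CSpace (m + 1))) = XStar m := by
  refine Subset.antisymm ?_ ?_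
  · rintro _ ⟨x, hx, rfl⟩
    exact norm_pos_iff.2 hx
  · rintro ⟨r, L⟩ hr
    have hr : 0 < r := hr
    induction L using Projectivization.ind with | h z hz =>
    have hn : 0 < ‖z‖ := norm_pos_iff.2 hz
    have ht : ((r / ‖z‖ : ℝ) : ℂ) ≠ 0 := Complex.ofReal_ne_zero.2 (by positivity)
    refine ⟨((r / ‖z‖ : ℝ) : ℂ) • z, smul_ne_zero ht hz, ?_⟩
    rw [hopfProj_eq, hopfLine_smul ht hz, hopfLine_of_ne hz, norm_smul, Complex.norm_real,
      Real.norm_eq_abs, abs_of_pos (by positivity), div_mul_cancel₀ _ hn.ne']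

theorem surjective_modelDeriv_hopfProj {x : CSpace (m + 1)} (hx : x ≠ 0) :
    Function.Surjective (modelDeriv 𝓘(ℝ, CSpace (m + 1)) (XModel m) hopfProj x) := by
  rintro ⟨τ, ℓ⟩
  have hn : ‖x‖ ≠ 0 := norm_ne_zero_iff.2 hx
  obtain ⟨u, rfl⟩ := surjective_modelDeriv_hopfLine hx ℓ
  have h1 : dRho x x = ‖x‖ := by
    rw [dRho_apply, inner_self_re_im, Complex.ofReal_re]; field_simp
  refine ⟨u + ((τ - dRho x u) / ‖x‖) • x, ?_⟩
  rw [modelDeriv_hopfProj hx, map_add, map_add, map_smul, h1, ← Complex.coe_smul,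
    modelDeriv_hopfLine_smul hx, add_zero, smul_eq_mul, div_mul_cancel₀ _ hn]
  simp

/-- The vector $ix$ is vertical. Both $d\rho$ and the Fubini–Study form vanish on it while
$\theta(ix)=1$, so orthogonality to it reads $B\,\theta(u)=0$ with $B>0$. -/
theorem thetaForm_eq_zero_of_horizontal {c : ℝ} (hm : 1 ≤ m) (hc : 0 < c) {x : CSpace (m + 1)}
    (hx : x ≠ 0) {u : CSpace (m + 1)}
    (hu : ∀ k : CSpace (m + 1), modelDeriv 𝓘(ℝ, CSpace (m + 1)) (XModel m) hopfProj x k = 0 →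
      formEval 𝓘(ℝ, CSpace (m + 1)) (pullbackForm 𝓘(ℝ, CSpace (m + 1)) 𝓘(ℝ, CSpace (m + 1))
        (ballMap (m + 1) c) (ballMetric (m + 1) c)) x u k = 0) : thetaForm x u = 0 := by
  have hn : 2 ≤ m + 1 := by omega
  have hr : 0 < ‖x‖ := norm_pos_iff.2 hx
  have hker : modelDeriv 𝓘(ℝ, CSpace (m + 1)) (XModel m) hopfProj x (Complex.I • x) = 0 := by
    rw [modelDeriv_hopfProj hx, dRho_I_smul, modelDeriv_hopfLine_smul hx]
    rfl
  have horth := hu _ hker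
  rw [formEval_pullback_ballMetric hn hc hx, cohomOneForm_apply, dRho_I_smul, thetaForm_I_smul hx,
    fubiniStudyLift_symm, fubiniStudyLift_smul_self_left] at horth
  simpa [(fiberCoeff_pos hn hc hr).ne'] using horth

/-- The two metrics differ by $B\,\theta^2$, which dies as soon as one of the arguments is
horizontal. -/
theorem formEval_warpedForm_hopfProj_of_thetaForm {c : ℝ} (hm : 1 ≤ m) (hc : 0 < c)
    {x : CSpace (m + 1)} (hx : x ≠ 0) {u : CSpace (m + 1)} (hu : thetaForm x u = 0)
    (v : CSpace (m + 1)) :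
    formEval (XModel m) (warpedForm m (radialCoeff (m + 1) √c) (coneCoeff (m + 1))) (hopfProj x)
      (modelDeriv 𝓘(ℝ, CSpace (m + 1)) (XModel m) hopfProj x u)
      (modelDeriv 𝓘(ℝ, CSpace (m + 1)) (XModel m) hopfProj x v) =
    formEval 𝓘(ℝ, CSpace (m + 1)) (pullbackForm 𝓘(ℝ, CSpace (m + 1)) 𝓘(ℝ, CSpace (m + 1))
        (ballMap (m + 1) c) (ballMetric (m + 1) c)) x u v := by
  rw [formEval_warpedForm_hopfProj _ _ hx, formEval_pullback_ballMetric (by omega) hc hx,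
    cohomOneForm_apply, hu, zero_mul, mul_zero, add_zero]

theorem isRiemannianSubmersionOn_hopfProj {c : ℝ} (hm : 1 ≤ m) (hc : 0 < c) :
    IsRiemannianSubmersionOn 𝓘(ℝ, CSpace (m + 1)) (XModel m) {0}ᶜ (XStar m) hopfProj
      (pullbackForm 𝓘(ℝ, CSpace (m + 1)) 𝓘(ℝ, CSpace (m + 1)) (ballMap (m + 1) c)
        (ballMetric (m + 1) c))
      (warpedForm m (radialCoeff (m + 1) √c) (coneCoeff (m + 1))) where
  metric_source := isRiemannianMetricOn_pullback_ballMetric (by omega) hc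
  metric_target := isRiemannianMetricOn_warpedForm (contDiffOn_radialCoeff_sqrt (by omega) hc)
    (contDiff_coneCoeff _) (fun _ => radialCoeff_pos (by omega) hc)
    (fun _ => coneCoeff_pos (by omega))
  smooth := contMDiffOn_hopfProj
  image_eq := image_hopfProj
  submersion x hx := surjective_modelDeriv_hopfProj hx
  isometry x hx u v hu _ := formEval_warpedForm_hopfProj_of_thetaForm hm hc hx
    (thetaForm_eq_zero_of_horizontal hm hc hx hu) v

end Submersion

/-! ### Diameters of the circle fibers. -/

section Fibers

variable {m : ℕ}

theorem exists_exp_smul_eq_of_hopfProj_eq {x y : CSpace (m + 1)} (hx : x ≠ 0) (hy : y ≠ 0)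
    (h : hopfProj x = hopfProj y) :
    ∃ φ : ℝ, |φ| ≤ Real.pi ∧ y = Complex.exp (φ * Complex.I) • x := by
  rw [hopfProj_eq, hopfProj_eq, Prod.mk.injEq, hopfLine_of_ne hx, hopfLine_of_ne hy,
    Projectivization.mk_eq_mk_iff'] at h
  obtain ⟨hnorm, t, ht⟩ := h
  have ht0 : t ≠ 0 := by rintro rfl; exact hx (by simpa using ht.symm)
  have hy0 : ‖y‖ ≠ 0 := norm_ne_zero_iff.2 hy
  have ht1 : ‖t‖ = 1 := by
    rw [← ht, norm_smul] at hnorm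
    exact mul_right_cancel₀ hy0 (hnorm.trans (one_mul _).symm)
  have ht2 : ‖t⁻¹‖ = 1 := by rw [norm_inv, ht1, inv_one]
  refine ⟨Complex.arg t⁻¹, Complex.abs_arg_le_pi _, ?_⟩
  have h3 := Complex.norm_mul_exp_arg_mul_I t⁻¹
  rw [ht2, Complex.ofReal_one, one_mul] at h3
  rw [h3, ← ht, inv_smul_smul₀ ht0]

/-- Two points of a fiber differ by a phase of angle at most $\pi$, and the rotation arc joining
them has constant speed $|\varphi|\sqrt B$. -/
theorem intrinsicDiam_fiber_le {c : ℝ} (hm : 1 ≤ m) (hc : 0 < c) (b : ℝ × CP m) :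
    intrinsicDiam (pullbackForm 𝓘(ℝ, CSpace (m + 1)) 𝓘(ℝ, CSpace (m + 1)) (ballMap (m + 1) c)
        (ballMetric (m + 1) c)) {x : CSpace (m + 1) | x ≠ 0 ∧ hopfProj x = b} ≤
      ENNReal.ofReal (Real.pi * √(fiberCoeff (m + 1) c b.1)) := by
  have hn : 2 ≤ m + 1 := by omega
  refine iSup₂_le fun x hx => iSup₂_le fun y hy => ?_
  obtain ⟨hx0, hxb⟩ := hx
  obtain ⟨hy0, hyb⟩ := hy
  obtain ⟨φ, hφ, rfl⟩ := exists_exp_smul_eq_of_hopfProj_eq hx0 hy0 (hxb.trans hyb.symm)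
  set γ : ℝ → CSpace (m + 1) := fun t => Complex.exp ((φ * t : ℝ) * Complex.I) • x with hγ
  have hnorm : ∀ t, ‖γ t‖ = ‖x‖ := fun t => by
    rw [hγ, norm_smul, Complex.norm_exp_ofReal_mul_I, one_mul]
  have hne : ∀ t, γ t ≠ 0 := fun t => by
    rw [← norm_ne_zero_iff, hnorm]; exact norm_ne_zero_iff.2 hx0
  have hγ' : ∀ t, HasDerivAt γ (φ • Complex.I • γ t) t := fun t => by
    have h1 : HasDerivAt (fun t : ℝ => φ * t) φ t := by
      simpa using (hasDerivAt_id t).const_mul φ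
    have h2 := ((h1.ofReal_comp.mul_const Complex.I).cexp).smul_const x
    refine h2.congr_deriv ?_
    rw [hγ, ← Complex.coe_smul, smul_smul, smul_smul]
    congr 1
    ring
  have hsmooth : ContDiff ℝ 1 γ := by
    have h1 : ContDiff ℝ 1 (fun t : ℝ => ((φ * t : ℝ) : ℂ) * Complex.I) :=
      (Complex.ofRealCLM.contDiff.comp (contDiff_const.mul contDiff_id)).mul contDiff_const
    exact (Complex.contDiff_exp.comp h1).smul contDiff_const
  refine iInf₂_le_of_le γ ⟨hsmooth.contDiffOn, fun t _ => ⟨hne t, ?_⟩, by simp [hγ], by simp [hγ]⟩ ?_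
  · rw [← hxb, hopfProj_eq, hopfProj_eq, hnorm]
    simp only [hγ, hopfLine_smul (Complex.exp_ne_zero _) hx0]
  have hb : ‖x‖ = b.1 := by rw [← hxb]; rfl
  have hint : ∀ t ∈ Icc (0 : ℝ) 1, ENNReal.ofReal (√(formEval 𝓘(ℝ, CSpace (m + 1))
      (pullbackForm 𝓘(ℝ, CSpace (m + 1)) 𝓘(ℝ, CSpace (m + 1)) (ballMap (m + 1) c)
        (ballMetric (m + 1) c)) (γ t) (derivWithin γ (Icc 0 1) t) (derivWithin γ (Icc 0 1) t))) =
      ENNReal.ofReal (|φ| * √(fiberCoeff (m + 1) c b.1)) := by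
    intro t ht
    -- The velocity is $\varphi\, i\gamma$, a vertical vector on which only the $\theta^2$ term is
    -- nonzero.
    rw [(hγ' t).hasDerivWithinAt.derivWithin (uniqueDiffOn_Icc one_pos t ht),
      formEval_pullback_ballMetric hn hc (hne t), cohomOneForm_apply, map_smul, dRho_I_smul,
      map_smul, thetaForm_I_smul (hne t), ← Complex.coe_smul, smul_smul,
      fubiniStudyLift_smul_self_left, hnorm, hb]
    congr 1
    have : radialCoeff (m + 1) √c b.1 * (φ • (0 : ℝ) * φ • (0 : ℝ)) +
        fiberCoeff (m + 1) c b.1 * (φ • (1 : ℝ) * φ • (1 : ℝ)) + coneCoeff (m + 1) b.1 * 0 =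
        φ ^ 2 * fiberCoeff (m + 1) c b.1 := by
      simp only [smul_eq_mul]; ring
    rw [this, Real.sqrt_mul (sq_nonneg φ), Real.sqrt_sq_eq_abs]
  calc curveLength _ γ = ∫⁻ t in Icc (0 : ℝ) 1,
        ENNReal.ofReal (|φ| * √(fiberCoeff (m + 1) c b.1)) :=
        MeasureTheory.setLIntegral_congr_fun measurableSet_Icc hint
    _ = ENNReal.ofReal (|φ| * √(fiberCoeff (m + 1) c b.1)) := by simp
    _ ≤ _ := by gcongr

theorem tendsto_iSup_intrinsicDiam_fiber (hm : 1 ≤ m) (R : ℝ) :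
    Tendsto (fun c : ℝ => ⨆ b ∈ XBall m R,
        intrinsicDiam
          (pullbackForm 𝓘(ℝ, CSpace (m + 1)) 𝓘(ℝ, CSpace (m + 1)) (ballMap (m + 1) c)
            (ballMetric (m + 1) c))
          {x : CSpace (m + 1) | x ≠ 0 ∧ hopfProj x = b})
      (𝓝[>] 0) (𝓝 0) := by
  have hn : 2 ≤ m + 1 := by omega
  -- The bound on the fiber coefficient increases with $r$, so its value at $R$ serves all of $B_R$.
  -- Here `κ` is $X(R)$, not the constant $2n/(2n-3)$.
  set κ := coneCoeff (m + 1) R with hκ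
  set C : ℝ := (2 * ((m + 1 : ℕ) : ℝ) - 1) * κ + 2 * ((m + 1 : ℕ) : ℝ) with hC
  have hlim : Tendsto (fun c : ℝ => ENNReal.ofReal (Real.pi * √(√c * (C * √κ)))) (𝓝[>] 0) (𝓝 0) := by
    have h1 : Continuous (fun c : ℝ => ENNReal.ofReal (Real.pi * √(√c * (C * √κ)))) :=
      ENNReal.continuous_ofReal.comp (by fun_prop)
    have h2 := h1.tendsto 0
    simp only [Real.sqrt_zero, zero_mul, mul_zero, ENNReal.ofReal_zero] at h2
    exact h2.mono_left nhdsWithin_le_nhds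
  refine tendsto_of_tendsto_of_tendsto_of_le_of_le' tendsto_const_nhds hlim
    (Eventually.of_forall fun _ => zero_le) ?_
  filter_upwards [self_mem_nhdsWithin] with c hc
  have hc : 0 < c := hc
  refine iSup₂_le fun b hb => (intrinsicDiam_fiber_le hm hc b).trans ?_
  obtain ⟨hb0, hbR⟩ := hb
  have h0 := coneCoeff_nonneg hn b.1
  have h1 : coneCoeff (m + 1) b.1 ≤ κ := by
    have hs : Real.sinh b.1 ≤ Real.sinh R := Real.sinh_le_sinh.2 hbR.le
    have hs0 : 0 ≤ Real.sinh b.1 := Real.sinh_nonneg_iff.2 hb0.le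
    have := (coneConst_pos hn).le
    rw [hκ, coneCoeff, coneCoeff]
    gcongr
  have h2 : (0 : ℝ) ≤ 2 * ((m + 1 : ℕ) : ℝ) - 1 := by push_cast; linarith [(Nat.cast_nonneg m : (0 : ℝ) ≤ m)]
  refine ENNReal.ofReal_le_ofReal (mul_le_mul_of_nonneg_left (Real.sqrt_le_sqrt
    ((fiberCoeff_le hn hc hb0).trans ?_)) Real.pi_pos.le)
  have h3 : 0 ≤ (2 * ((m + 1 : ℕ) : ℝ) - 1) * κ + 2 * ((m + 1 : ℕ) : ℝ) :=
    add_nonneg (mul_nonneg h2 (coneCoeff_nonneg hn R)) (by positivity)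
  rw [hC]
  gcongr

end Fibers

end

/-! ### Assembly, with $n=m+1$. -/

theorem theorem3 (m : ℕ) (hm : 1 ≤ m) :
    ∃ Φ : ℝ → CSpace (m + 1) → CSpace (m + 1),
      -- SU(n)-equivariant diffeomorphisms onto the punctured ball, where n = m + 1
      (∀ c : ℝ, 0 < c →
        IsDiffeoOn (Φ c) {0}ᶜ (Metric.ball 0 1 \ {0}) ∧
        ∀ A ∈ Matrix.specialUnitaryGroup (Fin (m + 1)) ℂ, ∀ x : CSpace (m + 1), x ≠ 0 →
          Φ c (matAct A x) = matAct A (Φ c x)) ∧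
      -- (i)
      (∀ c : ℝ, 0 < c →
        ∃ h : CSpace (m + 1) ≃ₜ Metric.ball (0 : CSpace (m + 1)) 1,
          ∀ x : CSpace (m + 1), x ≠ 0 → (h x : CSpace (m + 1)) = Φ c x) ∧
      -- (ii)
      (∃ g' : ℝ → FormField (XModel m) (ℝ × CP m),
        (∀ c : ℝ, 0 < c →
          IsRiemannianSubmersionOn 𝓘(ℝ, CSpace (m + 1)) (XModel m) {0}ᶜ (XStar m) hopfProj
            (pullbackForm 𝓘(ℝ, CSpace (m + 1)) 𝓘(ℝ, CSpace (m + 1)) (Φ c)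
              (ballMetric (m + 1) c))
            (g' c)) ∧
        ∀ R₁ R₂ : ℝ, 0 < R₁ → R₁ < R₂ →
          SmoothlyConvergesOn (XModel m) (XAnnulus m R₁ R₂) g' (𝓝[>] 0) (limitMetric m)) ∧
      -- (iii)
      (∀ R : ℝ, 0 < R →
        Tendsto (fun c : ℝ => ⨆ b ∈ XBall m R,
            intrinsicDiam
              (pullbackForm 𝓘(ℝ, CSpace (m + 1)) 𝓘(ℝ, CSpace (m + 1)) (Φ c)
                (ballMetric (m + 1) c))
              {x : CSpace (m + 1) | x ≠ 0 ∧ hopfProj x = b})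
          (𝓝[>] 0) (𝓝 0)) := by
  have hn : 2 ≤ m + 1 := by omega
  refine ⟨ballMap (m + 1), fun c hc => ⟨isDiffeoOn_ballMap hn hc, fun A hA x _ =>
    ballMap_matAct hA x⟩, fun c hc => ?_, ⟨fun c => warpedForm m (radialCoeff (m + 1) √c)
      (coneCoeff (m + 1)), fun c hc => isRiemannianSubmersionOn_hopfProj hm hc,
      fun R₁ R₂ hR₁ _ => ?_⟩, fun R _ => tendsto_iSup_intrinsicDiam_fiber hm R⟩
  · obtain ⟨h, hh⟩ := exists_homeomorph_ballMap hn hc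
    exact ⟨h, fun x _ => hh x⟩
  · rw [limitMetric_eq]
    exact smoothlyConvergesOn_warpedForm hn hR₁
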